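/- Logarithms are natural, $\mathbb D(P\Vert Q)=\sum_a P(a)\log\frac{P(a)}{Q(a)}$ is the Kullback--Leibler divergence, and $P\ll Q$ denotes absolute continuity. Let $W$ and $V$ be binary-input discrete memoryless channels (BDMCs) with input alphabet $\{0,1\}$, where $0$ is the innocent symbol, and finite output alphabets $\mathcal Y$ (receiver) and $\mathcal Z$ (warden). Write $P_x=W(\cdot|x)$ and $Q_x=V(\cdot|x)$ for $x\in\{0,1\}$, and assume $Q_0\neq Q_1$, $Q_1\ll Q_0$ and $P_1\ll P_0$. Let $q:\{0,1\}\times\mathcal Y\to(0,\infty)$ be a decoding metric, $q^n(\mathbf x,\mathbf y)=\prod_{i=1}^n q(x_i,y_i)$, and let $\delta>0$. A code $\mathcal C$ of blocklength $n$ consists of a nonempty finite message set $\mathcal M$, a nonempty finite key set $\mathcal K$, and codewords $\mathbf x(m,k)\in\{0,1\}^n$ for $(m,k)\in\mathcal M\times\mathcal K$. Its maximal probability of error is $$P^{\max}_{\rm err}(\mathcal C)=\max_{m,k}\ W^{\otimes n}\bigl(\{\mathbf y:\ \exists\, m'\neq m,\ q^n(\mathbf x(m',k),\mathbf y)\ge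 q^n(\mathbf x(m,k),\mathbf y)\}\,\big|\,\mathbf x(m,k)\bigr),$$ and its output distribution at the warden is $\widehat Q^n_{\mathcal C}(\mathbf z)=\frac1{|\mathcal M||\mathcal K|}\sum_{m,k}V^{\otimes n}(\mathbf z|\mathbf x(m,k))$. A real rate pair $(R,R_K)$ is $(q,\delta)$-achievable if there is a sequence of codes, one for each blocklength $n$, such that $\liminf_n \frac{\log|\mathcal M|}{\sqrt n}\ge R$, $\limsup_n\frac{\log|\mathcal K|}{\sqrt n}\le R_K$, the limit $\lim_n \mathbb D(\widehat Q^n_{\mathcal C}\Vert Q_0^{\otimes n})$ exists and is at most $\delta$, and $\lim_n P^{\max}_{\rm err}(\mathcal C)=0$. The covert mismatch capacity $\mathsf C_{q,\delta}$ is the supremum (in the extended reals) of $R$ over all $(q,\delta)$-achievable rate pairs $(R,R_K)$. Let $$t_\delta=\sqrt{\frac{2\delta}{\chi_2(Q_1\Vert Q_0)}},\qquad \chi_2(Q_1\Vert Q_0)=\sum_{z}\frac{(Q_1(z)-Q_0(z))^2}{Q_0(z)}$$ (the sum being over $z$ with $Q_0(z)>0$), and $$\underline{\mathsf R}_{q,\delta}=t_\delta\cdot\sup_{s\ge0}\left(\mathbb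 E_{P_1}\!\left[\log\frac{q(1,Y)^s}{q(0,Y)^s}\right]-\log\mathbb E_{P_0}\!\left[\frac{q(1,Y)^s}{q(0,Y)^s}\right]\right).$$ Theorem (Lower bound). The supremum defining $\underline{\mathsf R}_{q,\delta}$ is finite; the rate pair $(\underline{\mathsf R}_{q,\delta},R_K)$ is $(q,\delta)$-achievable for every $R_K\ge\max\{0,\ t_\delta\,\mathbb D(Q_1\Vert Q_0)-\underline{\mathsf R}_{q,\delta}\}$; and consequently $\mathsf C_{q,\delta}\ge\underline{\mathsf R}_{q,\delta}$. -/

import Mathlib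

open Filter Topology

noncomputable section

namespace CovertMismatch

/-- A binary-input discrete memoryless channel with input alphabet `{0, 1}` (`0` is the innocent
symbol) and finite output alphabet `Y`; `law x y` is the probability of output `y` on input `x`. -/
structure BDMC (Y : Type*) [Fintype Y] where
  law : Fin 2 → Y → ℝ
  nonneg : ∀ x y, 0 ≤ law x y
  sum_eq_one : ∀ x, ∑ y, law x y = 1

/-- The law of `n` uses of the channel: `W^{⊗n}(y | x) = ∏ i, W(y_i | x_i)`. -/
def BDMC.prodLaw {Y : Type*} [Fintype Y] (W : BDMC Y) {n : ℕ} (x : Fin n → Fin 2)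
    (y : Fin n → Y) : ℝ :=
  ∏ i, W.law (x i) (y i)

/-- Absolute continuity `P ≪ Q` of mass functions on a finite set. -/
def AbsCont {A : Type*} (P Q : A → ℝ) : Prop :=
  ∀ a, Q a = 0 → P a = 0

/-- Kullback-Leibler divergence (in nats) of mass functions on a finite set, for `P ≪ Q`;
the terms with `P a = 0` vanish, as in the usual convention. -/
def klDivergence {A : Type*} [Fintype A] (P Q : A → ℝ) : ℝ :=
  ∑ a, P a * Real.log (P a / Q a)

/-- The `χ²`-distance of mass functions on a finite set, for `P ≪ Q`;
the terms with `P a = Q a = 0` vanish. -/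
def chiSq {A : Type*} [Fintype A] (P Q : A → ℝ) : ℝ :=
  ∑ a, (P a - Q a) ^ 2 / Q a

/-- A code of blocklength `n`: nonempty finite sets of `numMsg` messages and `numKey` keys, and a
codeword `word m k` in `{0, 1}^n` for every message-key pair. -/
structure Code (n : ℕ) where
  numMsg : ℕ
  numKey : ℕ
  numMsg_pos : 0 < numMsg
  numKey_pos : 0 < numKey
  word : Fin numMsg → Fin numKey → Fin n → Fin 2

/-- The `n`-letter decoding metric `q^n(x, y) = ∏ i, q(x_i, y_i)`. -/
def prodMetric {Y : Type*} (q : Fin 2 → Y → ℝ) {n : ℕ} (x : Fin n → Fin 2) (y : Fin n → Y) : ℝ :=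
  ∏ i, q (x i) (y i)

open Classical in
/-- Probability of error for the message-key pair `(m, k)`: the decoder knows `k` and errs when
another message has a metric at least as large as that of `m` (ties are errors). -/
def errProb {Y : Type*} [Fintype Y] (q : Fin 2 → Y → ℝ) (W : BDMC Y) {n : ℕ} (C : Code n)
    (m : Fin C.numMsg) (k : Fin C.numKey) : ℝ :=
  ∑ y : Fin n → Y,
    if ∃ m', m' ≠ m ∧ prodMetric q (C.word m k) y ≤ prodMetric q (C.word m' k) y then
      W.prodLaw (C.word m k) y
    else 0

/-- Maximal probability of error over all message-key pairs. -/
def maxErrProb {Y : Type*} [Fintype Y] (q : Fin 2 → Y → ℝ) (W : BDMC Y) {n : ℕ} (C : Code n) : ℝ :=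
  ⨆ p : Fin C.numMsg × Fin C.numKey, errProb q W C p.1 p.2

/-- Output distribution at the warden when the message and the key are uniform. -/
def wardenLaw {Z : Type*} [Fintype Z] (V : BDMC Z) {n : ℕ} (C : Code n) (z : Fin n → Z) : ℝ :=
  1 / ((C.numMsg : ℝ) * (C.numKey : ℝ)) * ∑ m, ∑ k, V.prodLaw (C.word m k) z

/-- Output distribution `Q_0^{⊗n}` at the warden when only the innocent symbol is sent. -/
def innocentLaw {Z : Type*} [Fintype Z] (V : BDMC Z) (n : ℕ) (z : Fin n → Z) : ℝ :=
  ∏ i, V.law 0 (z i)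

/-- `(q, δ)`-achievability of the rate pair `(R, RK)` over the receiver's channel `W` and the
warden's channel `V`. The lower and upper limits are taken in the extended reals. -/
def Achievable {Y Z : Type*} [Fintype Y] [Fintype Z] (q : Fin 2 → Y → ℝ) (δ : ℝ)
    (W : BDMC Y) (V : BDMC Z) (R RK : ℝ) : Prop :=
  ∃ C : (n : ℕ) → Code n,
    (R : EReal) ≤
      liminf (fun n : ℕ => ((Real.log (C n).numMsg / √(n : ℝ) : ℝ) : EReal)) atTop ∧
    limsup (fun n : ℕ => ((Real.log (C n).numKey / √(n : ℝ) : ℝ) : EReal)) atTop ≤ (RK : EReal) ∧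
    (∃ d ≤ δ, Tendsto (fun n : ℕ => klDivergence (wardenLaw V (C n)) (innocentLaw V n))
      atTop (𝓝 d)) ∧
    Tendsto (fun n : ℕ => maxErrProb q W (C n)) atTop (𝓝 0)

/-- The covert mismatch capacity: the supremum, in the extended reals, of `R` over all
achievable rate pairs `(R, RK)`. -/
def capacity {Y Z : Type*} [Fintype Y] [Fintype Z] (q : Fin 2 → Y → ℝ) (δ : ℝ)
    (W : BDMC Y) (V : BDMC Z) : EReal :=
  sSup {r : EReal | ∃ R RK : ℝ, Achievable q δ W V R RK ∧ r = (R : EReal)}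

/-- The weight parameter `t_δ = √(2δ / χ²(Q_1 ‖ Q_0))`. -/
def weightParam {Z : Type*} [Fintype Z] (δ : ℝ) (V : BDMC Z) : ℝ :=
  √(2 * δ / chiSq (V.law 1) (V.law 0))

/-- `E_{P_1}[log (q(1,Y)^s / q(0,Y)^s)] - log E_{P_0}[q(1,Y)^s / q(0,Y)^s]`. -/
def rateFun {Y : Type*} [Fintype Y] (q : Fin 2 → Y → ℝ) (W : BDMC Y) (s : ℝ) : ℝ :=
  ∑ y, W.law 1 y * Real.log (q 1 y ^ s / q 0 y ^ s) -
    Real.log (∑ y, W.law 0 y * (q 1 y ^ s / q 0 y ^ s))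

/-- The rate `t_δ * sup_{s ≥ 0} rateFun s`. -/
def lowerRate {Y Z : Type*} [Fintype Y] [Fintype Z] (q : Fin 2 → Y → ℝ) (δ : ℝ)
    (W : BDMC Y) (V : BDMC Z) : ℝ :=
  weightParam δ V * sSup (rateFun q W '' Set.Ici 0)

end CovertMismatch

end

/-!
The lower bound is proved by random coding with sparse independent inputs followed by expurgation.

Let `t = t_δ`. Draw all codewords of length `n` independently, with independent symbols that equal `1`
with probability `t / √n`. The warden's mean output law is then the product of the mixtures
`(1 - t / √n) Q_0 + (t / √n) Q_1`, whose divergence from `Q_0^{⊗n}` tends to `t² χ² / 2 = δ`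
(`tendsto_klDivergence_mixLaw`). Soft covering (`iidExp_soft_covering`), applied with a Chernoff bound
for the information density, makes the law induced by the codebook exponentially close in `√n` to
this mean in `L¹`, once the codebook has more than `exp (t D(Q_1 ‖ Q_0) √n)` words. As all densities
involved are at most exponential in `n`, an `L¹` distance that is `o(1/n)` transfers to the divergence
(`abs_klDivergence_sub_le`).

For the receiver, fix `s ≥ 0` and give the output letter `y` the score
`log (q(1,y)^s / q(0,y)^s) - log E_{P_0}[q(1,Y)^s / q(0,Y)^s]`. The sum of the scores over the pulses
of the sent word concentrates at `t √n * rateFun s`, whereas the exponential of the same sum over the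
pulses of an independent word has bounded mean, because two sparse words overlap in boundedly many
places. So a union bound tolerates `exp (ρ √n)` messages for `ρ < t * rateFun s`
(`iidExp_pairScore_le`). Subtracting the logarithm in the score changes the comparison of two metrics
only through the difference of the weights of the two words, and these concentrate (`errProb_le`);
without this subtraction one would only get `1 - E_{P_0}[q(1,Y)^s / q(0,Y)^s]` in place of the
logarithm.

The mean over all pairs of the error bounds is exponentially small in `√n`, so removing an
exponentially small fraction of the codebook bounds the maximal error and moves the warden's law
negligibly in `L¹` (`exists_expurgation`, `sum_abs_avg_sub_avg_le`). Letting the margins in the rates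
tend to `0` along a diagonal sequence gives the boundary rates (`exists_seq_of_eventually_exists`).
-/

namespace CovertMismatch

/-! ### Expectations over independent identically distributed families -/

section IidExp

variable {I A : Type*} [Fintype I] [Fintype A]

/-- The expectation of `F c` when the entries `c i` of the family `c : I → A` are drawn
independently with the mass function `p`. -/
noncomputable def iidExp (p : A → ℝ) (F : (I → A) → ℝ) : ℝ := by
  classical exact ∑ c : I → A, (∏ i, p (c i)) * F c

theorem iidExp_eq [DecidableEq I] (p : A → ℝ) (F : (I → A) → ℝ) :
    iidExp p F = ∑ c : I → A, (∏ i, p (c i)) * F c := by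
  unfold iidExp
  congr!

theorem iidExp_add (p : A → ℝ) (F G : (I → A) → ℝ) :
    iidExp p (fun c => F c + G c) = iidExp p F + iidExp p G := by
  simp [iidExp, mul_add, Finset.sum_add_distrib]

theorem iidExp_const_mul (p : A → ℝ) (r : ℝ) (F : (I → A) → ℝ) :
    iidExp p (fun c => r * F c) = r * iidExp p F := by
  simp only [iidExp, Finset.mul_sum]
  exact Finset.sum_congr rfl fun c _ => by ring

theorem iidExp_sum {J : Type*} (s : Finset J) (p : A → ℝ) (F : J → (I → A) → ℝ) :
    iidExp p (fun c => ∑ j ∈ s, F j c) = ∑ j ∈ s, iidExp p (F j) := by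
  simp only [iidExp, Finset.mul_sum]
  exact Finset.sum_comm

theorem iidExp_mono {p : A → ℝ} (hp : ∀ a, 0 ≤ p a) {F G : (I → A) → ℝ} (h : ∀ c, F c ≤ G c) :
    iidExp p F ≤ iidExp p G :=
  Finset.sum_le_sum fun c _ =>
    mul_le_mul_of_nonneg_left (h c) (Finset.prod_nonneg fun _ _ => hp _)

theorem iidExp_prod (p : A → ℝ) (g : I → A → ℝ) :
    iidExp p (fun c => ∏ i, g i (c i)) = ∏ i, ∑ a, p a * g i a := by
  classical
  rw [Finset.prod_univ_sum, iidExp_eq, Fintype.piFinset_univ]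
  simp only [Finset.prod_mul_distrib]

theorem iidExp_one {p : A → ℝ} (hp : ∑ a, p a = 1) : iidExp (I := I) p (fun _ => 1) = 1 := by
  simpa [hp] using iidExp_prod (I := I) p (fun _ _ => 1)

theorem iidExp_const {p : A → ℝ} (hp : ∑ a, p a = 1) (r : ℝ) :
    iidExp (I := I) p (fun _ => r) = r := by
  simpa [iidExp_one hp] using iidExp_const_mul (I := I) p r (fun _ => 1)

theorem iidExp_mul_apply {p : A → ℝ} (hp : ∑ a, p a = 1) {i j : I} (hij : i ≠ j) (f g : A → ℝ) :
    iidExp p (fun c : I → A => f (c i) * g (c j)) = (∑ a, p a * f a) * ∑ a, p a * g a := by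
  classical
  have h := iidExp_prod p
    (fun k a => (if k = i then f a else 1) * (if k = j then g a else 1) : I → A → ℝ)
  simp only [Finset.prod_mul_distrib, Finset.prod_ite_eq', Finset.mem_univ, if_true] at h
  rw [h, ← Finset.mul_prod_erase _ _ (Finset.mem_univ i),
    ← Finset.mul_prod_erase _ _ (Finset.mem_erase.2 ⟨hij.symm, Finset.mem_univ j⟩)]
  rw [Finset.prod_eq_one]
  · simp [hij, hij.symm]
  · intro k hk
    simp only [Finset.mem_erase, Finset.mem_univ, and_true] at hk
    simp [hk.1, hk.2, hp]

theorem iidExp_apply {p : A → ℝ} (hp : ∑ a, p a = 1) (i : I) (f : A → ℝ) :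
    iidExp p (fun c : I → A => f (c i)) = ∑ a, p a * f a := by
  classical
  have h := iidExp_prod p (fun k a => if k = i then f a else 1 : I → A → ℝ)
  simp only [Finset.prod_ite_eq', Finset.mem_univ, if_true] at h
  rw [h, ← Finset.mul_prod_erase _ _ (Finset.mem_univ i), Finset.prod_eq_one]
  · simp
  · intro k hk
    simp only [Finset.mem_erase, Finset.mem_univ, and_true] at hk
    simp [hk, hp]

theorem iidExp_apply_apply {p : A → ℝ} (hp : ∑ a, p a = 1) {i j : I} (hij : i ≠ j)
    (f : A → A → ℝ) :
    iidExp p (fun c : I → A => f (c i) (c j)) = ∑ a, p a * ∑ b, p b * f a b := by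
  classical
  have h : ∀ c : I → A, f (c i) (c j) = ∑ b, f (c i) b * (if c j = b then 1 else 0) := by
    intro c; simp
  simp only [h]
  rw [iidExp_sum]
  have h2 : ∀ b, iidExp p (fun c : I → A => f (c i) b * (if c j = b then 1 else 0)) =
      (∑ a, p a * f a b) * p b := by
    intro b
    rw [iidExp_mul_apply hp hij (fun a => f a b) (fun a => if a = b then 1 else 0)]
    simp
  simp only [h2, Finset.sum_mul, Finset.mul_sum]
  rw [Finset.sum_comm]
  exact Finset.sum_congr rfl fun a _ => Finset.sum_congr rfl fun b _ => by ring

theorem iidExp_sum_sq {p : A → ℝ} (hp : ∑ a, p a = 1) (f : A → ℝ) (hf : ∑ a, p a * f a = 0) :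
    iidExp p (fun c : I → A => (∑ i, f (c i)) ^ 2) = Fintype.card I * ∑ a, p a * f a ^ 2 := by
  classical
  simp only [sq, Finset.sum_mul_sum]
  rw [iidExp_sum]
  have h : ∀ i : I, iidExp p (fun c : I → A => ∑ j, f (c i) * f (c j)) =
      ∑ a, p a * (f a * f a) := by
    intro i
    rw [iidExp_sum, Finset.sum_eq_single i]
    · exact iidExp_apply hp i (fun a => f a * f a)
    · intro j _ hj
      rw [iidExp_mul_apply hp hj.symm, hf, zero_mul]
    · simp
  simp [h]

theorem exists_le_of_iidExp_le {p : A → ℝ} (hp0 : ∀ a, 0 ≤ p a) (hp : ∑ a, p a = 1)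
    {F : (I → A) → ℝ} {r : ℝ} (h : iidExp p F ≤ r) : ∃ c, F c ≤ r := by
  classical
  by_contra! hc
  have h1 : iidExp (I := I) p (fun c => F c + -r) ≤ 0 := by
    rw [iidExp_add, iidExp_const hp]; linarith
  rw [iidExp_eq] at h1
  have h2 := (Finset.sum_eq_zero_iff_of_nonneg (fun c _ =>
    mul_nonneg (Finset.prod_nonneg fun i _ => hp0 (c i)) (by linarith [hc c] : 0 ≤ F c + -r))).1
    (le_antisymm h1 (Finset.sum_nonneg fun c _ =>
      mul_nonneg (Finset.prod_nonneg fun i _ => hp0 (c i)) (by linarith [hc c] : 0 ≤ F c + -r)))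
  have h3 := iidExp_one (I := I) hp
  rw [iidExp_eq] at h3
  rw [Finset.sum_eq_zero] at h3
  · exact zero_ne_one h3
  · intro c hcu
    rcases mul_eq_zero.1 (h2 c hcu) with h4 | h4
    · simp [h4]
    · linarith [hc c]

end IidExp

/-! ### Exponentially small sequences -/

/-- `f n ≤ exp (-c √n)` for some `c > 0` and all large `n`. -/
def IsExpSmall (f : ℕ → ℝ) : Prop := ∃ c > 0, ∀ᶠ n : ℕ in atTop, f n ≤ Real.exp (-c * √(n : ℝ))

theorem tendsto_sqrt_natCast : Tendsto (fun n : ℕ => √(n : ℝ)) atTop atTop :=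
  Real.tendsto_sqrt_atTop.comp tendsto_natCast_atTop_atTop

theorem IsExpSmall.mono {f g : ℕ → ℝ} (hg : IsExpSmall g) (h : ∀ᶠ n in atTop, f n ≤ g n) :
    IsExpSmall f := by
  obtain ⟨c, hc, hg⟩ := hg
  exact ⟨c, hc, by filter_upwards [hg, h] with n h1 h2 using h2.trans h1⟩

theorem isExpSmall_const_mul_exp (r : ℝ) {c : ℝ} (hc : 0 < c) :
    IsExpSmall fun n => r * Real.exp (-c * √(n : ℝ)) := by
  refine ⟨c / 2, by positivity, ?_⟩
  have h := tendsto_sqrt_natCast.eventually_ge_atTop (r / (c / 2))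
  filter_upwards [h] with n hn
  have h1 : r ≤ Real.exp (c / 2 * √(n : ℝ)) := by
    rw [div_le_iff₀ (by positivity)] at hn
    linarith [Real.add_one_le_exp (c / 2 * √(n : ℝ))]
  calc r * Real.exp (-c * √(n : ℝ))
      ≤ Real.exp (c / 2 * √(n : ℝ)) * Real.exp (-c * √(n : ℝ)) := by gcongr
    _ = _ := by rw [← Real.exp_add]; ring_nf

theorem IsExpSmall.add {f g : ℕ → ℝ} (hf : IsExpSmall f) (hg : IsExpSmall g) :
    IsExpSmall fun n => f n + g n := by
  obtain ⟨c, hc, hf⟩ := hf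
  obtain ⟨d, hd, hg⟩ := hg
  refine (isExpSmall_const_mul_exp 2 (lt_min hc hd)).mono ?_
  filter_upwards [hf, hg] with n h1 h2
  have h3 : Real.exp (-c * √(n : ℝ)) ≤ Real.exp (-min c d * √(n : ℝ)) := by
    gcongr; exact min_le_left _ _
  have h4 : Real.exp (-d * √(n : ℝ)) ≤ Real.exp (-min c d * √(n : ℝ)) := by
    gcongr; exact min_le_right _ _
  linarith

theorem IsExpSmall.const_mul {f : ℕ → ℝ} (hf : IsExpSmall f) {r : ℝ} (hr : 0 ≤ r) :
    IsExpSmall fun n => r * f n := by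
  obtain ⟨c, hc, hf⟩ := hf
  refine (isExpSmall_const_mul_exp r hc).mono ?_
  filter_upwards [hf] with n h1
  gcongr

theorem tendsto_natCast_mul_exp_neg_sqrt {c : ℝ} (hc : 0 < c) :
    Tendsto (fun n : ℕ => (n : ℝ) * Real.exp (-c * √(n : ℝ))) atTop (𝓝 0) := by
  have h := (Real.tendsto_pow_mul_exp_neg_atTop_nhds_zero 2).comp
    (tendsto_sqrt_natCast.const_mul_atTop hc)
  have h2 := h.const_mul ((c ^ 2)⁻¹)
  rw [mul_zero] at h2
  refine h2.congr fun n => ?_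
  have h3 : √(n : ℝ) ^ 2 = n := Real.sq_sqrt (Nat.cast_nonneg n)
  simp only [Function.comp, mul_pow, h3]
  field_simp

theorem tendsto_exp_neg_sqrt {c : ℝ} (hc : 0 < c) :
    Tendsto (fun n : ℕ => Real.exp (-c * √(n : ℝ))) atTop (𝓝 0) := by
  simpa [Function.comp_def] using Real.tendsto_exp_neg_atTop_nhds_zero.comp
    (tendsto_sqrt_natCast.const_mul_atTop hc)

/-! ### Sparse inputs and Chernoff bounds -/

/-- The Bernoulli mass function on the input alphabet, of mass `α` at the symbol `1`. -/
def bern (α : ℝ) : Fin 2 → ℝ := ![1 - α, α]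

theorem bern_nonneg {α : ℝ} (h0 : 0 ≤ α) (h1 : α ≤ 1) (a : Fin 2) : 0 ≤ bern α a := by
  fin_cases a <;> simp [bern, h0, h1]

theorem sum_bern (α : ℝ) : ∑ a, bern α a = 1 := by simp [bern]

section PulseSum

variable {Y : Type*} {n : ℕ}

/-- The sum of `h (y i)` over the positions `i` at which the input `x` has the symbol `1`. -/
def pulseSum (h : Y → ℝ) (x : Fin n → Fin 2) (y : Fin n → Y) : ℝ :=
  ∑ i, if x i = 1 then h (y i) else 0

theorem pulseSum_neg (h : Y → ℝ) (x : Fin n → Fin 2) (y : Fin n → Y) :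
    pulseSum (fun b => -h b) x y = -pulseSum h x y := by
  simp only [pulseSum, ← Finset.sum_neg_distrib]
  exact Finset.sum_congr rfl fun i _ => by split_ifs <;> simp

theorem exp_pulseSum (h : Y → ℝ) (x : Fin n → Fin 2) (y : Fin n → Y) :
    Real.exp (pulseSum h x y) = ∏ i, if x i = 1 then Real.exp (h (y i)) else 1 := by
  rw [pulseSum, Real.exp_sum]
  exact Finset.prod_congr rfl fun i _ => by split_ifs <;> simp

end PulseSum

section Channel

variable {Y : Type*} [Fintype Y] {n : ℕ}

theorem BDMC.prodLaw_nonneg (W : BDMC Y) (x : Fin n → Fin 2) (y : Fin n → Y) :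
    0 ≤ W.prodLaw x y :=
  Finset.prod_nonneg fun _ _ => W.nonneg _ _

theorem BDMC.sum_prodLaw_mul_prod (W : BDMC Y) (x : Fin n → Fin 2) (g : Fin n → Y → ℝ) :
    ∑ y, W.prodLaw x y * ∏ i, g i (y i) = ∏ i, ∑ b, W.law (x i) b * g i b := by
  rw [Finset.prod_univ_sum, Fintype.piFinset_univ]
  simp only [BDMC.prodLaw, Finset.prod_mul_distrib]

theorem BDMC.sum_prodLaw (W : BDMC Y) (x : Fin n → Fin 2) : ∑ y, W.prodLaw x y = 1 := by
  simpa [W.sum_eq_one] using W.sum_prodLaw_mul_prod x (fun _ _ => 1)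

/-- The conditional probability, given the input `x`, that the pulse sum of `h` is at least `a`. -/
noncomputable def tailProb (W : BDMC Y) (h : Y → ℝ) (x : Fin n → Fin 2) (a : ℝ) : ℝ :=
  ∑ y, W.prodLaw x y * if a ≤ pulseSum h x y then 1 else 0

theorem tailProb_nonneg (W : BDMC Y) (h : Y → ℝ) (x : Fin n → Fin 2) (a : ℝ) :
    0 ≤ tailProb W h x a :=
  Finset.sum_nonneg fun y _ => mul_nonneg (W.prodLaw_nonneg x y) (by split_ifs <;> simp)

theorem iidExp_bern_exp_pulseSum (W : BDMC Y) (h : Y → ℝ) (α : ℝ) :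
    iidExp (I := Fin n) (bern α) (fun x => ∑ y, W.prodLaw x y * Real.exp (pulseSum h x y)) =
      (1 + α * (∑ b, W.law 1 b * Real.exp (h b) - 1)) ^ n := by
  have h1 : ∀ x : Fin n → Fin 2, ∑ y, W.prodLaw x y * Real.exp (pulseSum h x y) =
      ∏ i, ∑ b, W.law (x i) b * if x i = 1 then Real.exp (h b) else 1 := by
    intro x
    rw [← W.sum_prodLaw_mul_prod x (fun i b => if x i = 1 then Real.exp (h b) else 1)]
    simp only [exp_pulseSum]
  simp only [h1]
  rw [iidExp_prod (bern α) (fun (_ : Fin n) a =>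
    ∑ b, W.law a b * if a = 1 then Real.exp (h b) else 1)]
  simp only [Fin.sum_univ_two, Finset.prod_const, Finset.card_univ, Fintype.card_fin]
  congr 1
  simp [bern, W.sum_eq_one]
  ring

theorem tailProb_le (W : BDMC Y) (h : Y → ℝ) (x : Fin n → Fin 2) (a : ℝ) {r : ℝ} (hr : 0 ≤ r) :
    tailProb W h x a ≤
      Real.exp (-(r * a)) * ∑ y, W.prodLaw x y * Real.exp (pulseSum (fun b => r * h b) x y) := by
  rw [tailProb, Finset.mul_sum]
  refine Finset.sum_le_sum fun y _ => ?_
  have h1 : pulseSum (fun b => r * h b) x y = r * pulseSum h x y := by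
    simp only [pulseSum, Finset.mul_sum]
    exact Finset.sum_congr rfl fun i _ => by split_ifs <;> simp
  rw [mul_left_comm, ← Real.exp_add, h1]
  refine mul_le_mul_of_nonneg_left ?_ (W.prodLaw_nonneg x y)
  split_ifs with h2
  · rw [Real.one_le_exp_iff]
    nlinarith
  · positivity

/-- Chernoff bound: under sparse independent inputs the number of pulses is about `t √n`, and the
pulse sum exceeds `t √n` times its mean per pulse by `ε √n` with exponentially small
probability. -/
theorem isExpSmall_tailProb (W : BDMC Y) (h : Y → ℝ) {t ε : ℝ} (ht : 0 < t) (hε : 0 < ε) :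
    IsExpSmall fun n => iidExp (I := Fin n) (bern (t / √(n : ℝ)))
      (fun x => tailProb W h x ((t * ∑ b, W.law 1 b * h b + ε) * √(n : ℝ))) := by
  set μ := ∑ b, W.law 1 b * h b with hμ
  set H := ∑ b, W.law 1 b * h b ^ 2 with hH
  have hH0 : 0 ≤ H := Finset.sum_nonneg fun b _ => mul_nonneg (W.nonneg _ _) (sq_nonneg _)
  set S := ∑ b, |h b| with hS
  have hS0 : 0 ≤ S := Finset.sum_nonneg fun b _ => abs_nonneg _
  -- small enough for `exp u ≤ 1 + u + u²` and for the quadratic term to cost at most `ε / 2`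
  obtain ⟨r, hr0, hrS, hrH⟩ : ∃ r > 0, r * S ≤ 1 ∧ r * (t * H) ≤ ε / 2 := by
    refine ⟨min (1 / (S + 1)) (ε / 2 / (t * H + 1)), by positivity, ?_, ?_⟩
    · calc _ ≤ 1 / (S + 1) * (S + 1) := by gcongr; exacts [min_le_left _ _, by linarith]
        _ = 1 := by field_simp
    · calc _ ≤ ε / 2 / (t * H + 1) * (t * H + 1) := by
            gcongr; exacts [min_le_right _ _, by linarith]
        _ = ε / 2 := by field_simp
  have hmgf : ∑ b, W.law 1 b * Real.exp (r * h b) - 1 ≤ r * μ + r ^ 2 * H := by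
    have h1 : ∀ b, Real.exp (r * h b) ≤ 1 + r * h b + (r * h b) ^ 2 := by
      intro b
      have h2 : |r * h b| ≤ 1 := by
        rw [abs_mul, abs_of_pos hr0]
        refine le_trans ?_ hrS
        gcongr
        exact Finset.single_le_sum (f := fun b => |h b|) (fun b _ => abs_nonneg _)
          (Finset.mem_univ b)
      have h3 := (abs_le.1 (Real.abs_exp_sub_one_sub_id_le h2)).2
      linarith
    have h4 : ∑ b, W.law 1 b * Real.exp (r * h b) ≤
        ∑ b, (W.law 1 b + r * (W.law 1 b * h b) + r ^ 2 * (W.law 1 b * h b ^ 2)) :=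
      Finset.sum_le_sum fun b _ => by
        have := mul_le_mul_of_nonneg_left (h1 b) (W.nonneg 1 b)
        linarith
    rw [Finset.sum_add_distrib, Finset.sum_add_distrib, W.sum_eq_one, ← Finset.mul_sum,
      ← Finset.mul_sum] at h4
    linarith
  refine ⟨r * ε / 2, by positivity, ?_⟩
  filter_upwards [tendsto_sqrt_natCast.eventually_ge_atTop (t + 1)] with n hn
  set s := √(n : ℝ) with hs
  have hs0 : 0 < s := by linarith
  have hns : (n : ℝ) = s * s := (Real.mul_self_sqrt (Nat.cast_nonneg n)).symm
  have hα0 : 0 ≤ t / s := by positivity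
  have hα1 : t / s ≤ 1 := by rw [div_le_one hs0]; linarith
  have hbase : (0 : ℝ) ≤ 1 + t / s * (∑ b, W.law 1 b * Real.exp (r * h b) - 1) := by
    have : 0 ≤ ∑ b, W.law 1 b * Real.exp (r * h b) :=
      Finset.sum_nonneg fun b _ => mul_nonneg (W.nonneg _ _) (Real.exp_pos _).le
    nlinarith
  calc iidExp (I := Fin n) (bern (t / s)) (fun x => tailProb W h x ((t * μ + ε) * s))
      ≤ iidExp (I := Fin n) (bern (t / s)) (fun x => Real.exp (-(r * ((t * μ + ε) * s))) *
          ∑ y, W.prodLaw x y * Real.exp (pulseSum (fun b => r * h b) x y)) :=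
        iidExp_mono (bern_nonneg hα0 hα1) fun x => tailProb_le W h x _ hr0.le
    _ = Real.exp (-(r * ((t * μ + ε) * s))) *
          (1 + t / s * (∑ b, W.law 1 b * Real.exp (r * h b) - 1)) ^ n := by
        rw [iidExp_const_mul, iidExp_bern_exp_pulseSum]
    _ ≤ Real.exp (-(r * ((t * μ + ε) * s))) *
          (Real.exp (t / s * (r * μ + r ^ 2 * H))) ^ n := by
        gcongr
        have := mul_le_mul_of_nonneg_left hmgf hα0
        linarith [Real.add_one_le_exp (t / s * (r * μ + r ^ 2 * H))]
    _ = Real.exp (-(r * ((t * μ + ε) * s)) + t * (r * μ + r ^ 2 * H) * s) := by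
        rw [← Real.exp_nat_mul, ← Real.exp_add, hns]
        congr 1
        field_simp
    _ ≤ Real.exp (-(r * ε / 2) * s) := by
        gcongr
        have : r * (r * (t * H)) * s ≤ r * (ε / 2) * s := by gcongr
        nlinarith

/-- Independent sparse inputs `x`, `x'` overlap in a bounded number of positions on average, so
that an exponential pulse sum over `x'`, normalised under the innocent output law, has a bounded
expectation under the output law of `x`. -/
theorem iidExp_cross_exp_pulseSum_le (W : BDMC Y) (h : Y → ℝ)
    (hh : ∑ b, W.law 0 b * Real.exp (h b) = 1) {t : ℝ} (ht : 0 < t) (hn : t ≤ √(n : ℝ)) :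
    iidExp (I := Fin n) (bern (t / √(n : ℝ))) (fun x =>
      iidExp (I := Fin n) (bern (t / √(n : ℝ))) (fun x' =>
        ∑ y, W.prodLaw x y * Real.exp (pulseSum h x' y))) ≤
      Real.exp (t ^ 2 * ∑ b, W.law 1 b * Real.exp (h b)) := by
  set s := √(n : ℝ) with hs
  set κ := ∑ b, W.law 1 b * Real.exp (h b) with hκ
  have hκ0 : 0 ≤ κ := Finset.sum_nonneg fun b _ => mul_nonneg (W.nonneg _ _) (Real.exp_pos _).le
  have hs0 : 0 < s := by linarith
  have hns : (n : ℝ) = s * s := (Real.mul_self_sqrt (Nat.cast_nonneg n)).symm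
  have hα0 : 0 ≤ t / s := by positivity
  have hα1 : t / s ≤ 1 := by rw [div_le_one hs0]; linarith
  have h1 : ∀ x x' : Fin n → Fin 2, ∑ y, W.prodLaw x y * Real.exp (pulseSum h x' y) =
      ∏ i, ∑ b, W.law (x i) b * if x' i = 1 then Real.exp (h b) else 1 := by
    intro x x'
    rw [← W.sum_prodLaw_mul_prod x (fun i b => if x' i = 1 then Real.exp (h b) else 1)]
    simp only [exp_pulseSum]
  simp only [h1]
  have h2 : ∀ x : Fin n → Fin 2, iidExp (bern (t / s)) (fun x' : Fin n → Fin 2 =>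
      ∏ i, ∑ b, W.law (x i) b * if x' i = 1 then Real.exp (h b) else 1) =
      ∏ i, ∑ a, bern (t / s) a * ∑ b, W.law (x i) b * if a = 1 then Real.exp (h b) else 1 :=
    fun x => iidExp_prod (bern (t / s)) (fun i a =>
      ∑ b, W.law (x i) b * if a = 1 then Real.exp (h b) else 1)
  simp only [h2]
  rw [iidExp_prod (bern (t / s)) (fun (_ : Fin n) a' =>
    ∑ a, bern (t / s) a * ∑ b, W.law a' b * if a = 1 then Real.exp (h b) else 1)]
  simp only [Fin.sum_univ_two, Finset.prod_const, Finset.card_univ, Fintype.card_fin]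
  simp only [bern, Matrix.cons_val_zero, Matrix.cons_val_one, Fin.zero_eq_one_iff, if_true,
    OfNat.ofNat_ne_one, if_false, mul_one, W.sum_eq_one, hh, ← hκ]
  calc _ = (1 + (t / s) ^ 2 * (κ - 1)) ^ n := by congr 1; ring
    _ ≤ (Real.exp ((t / s) ^ 2 * κ)) ^ n := by
        gcongr
        · nlinarith [pow_le_one₀ hα0 hα1 (n := 2), sq_nonneg (t / s)]
        · nlinarith [Real.add_one_le_exp ((t / s) ^ 2 * κ), sq_nonneg (t / s)]
    _ = _ := by
        rw [← Real.exp_nat_mul, hns]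
        congr 1
        field_simp

end Channel

/-! ### Soft covering -/

/-- Soft covering in `L¹`: the average of `v (c i)` over independent draws `c i` is close to its
mean `Σ a, p a * v a`. The mass where `v a z > G * B z` is counted in full; what remains has a
second moment of order `G / card I`. -/
theorem iidExp_soft_covering {I A Z : Type*} [Fintype I] [Nonempty I] [Fintype A] [Fintype Z]
    {p : A → ℝ} (hp0 : ∀ a, 0 ≤ p a) (hp : ∑ a, p a = 1) {v : A → Z → ℝ} (hv0 : ∀ a z, 0 ≤ v a z)
    (hv : ∀ a, ∑ z, v a z = 1) {B : Z → ℝ} (hB0 : ∀ z, 0 ≤ B z) (hB : ∑ z, B z = 1)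
    {G κ : ℝ} (hG0 : 0 ≤ G) (hκ : 0 < κ) (hG : G ≤ κ ^ 2 * Fintype.card I) :
    iidExp p (fun c : I → A =>
      ∑ z, |(1 / (Fintype.card I : ℝ)) * ∑ i, v (c i) z - ∑ a, p a * v a z|) ≤
      2 * ∑ a, p a * ∑ z, (if G * B z < v a z then v a z else 0) + κ := by
  set N : ℝ := (Fintype.card I : ℝ) with hN
  have hN0 : 0 < N := by rw [hN]; exact_mod_cast Fintype.card_pos
  set hi : A → Z → ℝ := fun a z => if G * B z < v a z then v a z else 0 with hhi
  set lo : A → Z → ℝ := fun a z => if G * B z < v a z then 0 else v a z with hlo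
  have hsplit : ∀ a z, v a z = lo a z + hi a z := by
    intro a z; simp only [hhi, hlo]; split_ifs <;> simp
  have hloB : ∀ a z, lo a z ^ 2 ≤ G * B z * v a z := by
    intro a z
    simp only [hlo]
    split_ifs with h1
    · have := mul_nonneg (mul_nonneg hG0 (hB0 z)) (hv0 a z)
      simpa using this
    · push Not at h1
      nlinarith [hv0 a z]
  have hhi0 : ∀ a z, 0 ≤ hi a z := by
    intro a z; simp only [hhi]; split_ifs <;> simp [hv0]
  set Q : Z → ℝ := fun z => ∑ a, p a * v a z with hQ
  set L : Z → ℝ := fun z => ∑ a, p a * lo a z with hL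
  set H : Z → ℝ := fun z => ∑ a, p a * hi a z with hH
  have hH0 : ∀ z, 0 ≤ H z := fun z => Finset.sum_nonneg fun a _ => mul_nonneg (hp0 a) (hhi0 a z)
  have hQ0 : ∀ z, 0 ≤ Q z := fun z => Finset.sum_nonneg fun a _ => mul_nonneg (hp0 a) (hv0 a z)
  have hQLH : ∀ z, Q z = L z + H z := by
    intro z
    simp only [hQ, hL, hH, ← Finset.sum_add_distrib, ← mul_add, ← hsplit]
  have hQsum : ∑ z, Q z = 1 := by
    simp only [hQ]
    rw [Finset.sum_comm]
    simp only [← Finset.mul_sum, hv, mul_one, hp]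
  -- the truncated part, by its second moment
  have htrunc : ∀ z, iidExp p (fun c : I → A => 1 / N * |∑ i, (lo (c i) z - L z)|) ≤
      κ * (Q z + B z) / 2 := by
    intro z
    have hvar : iidExp p (fun c : I → A => (∑ i, (lo (c i) z - L z)) ^ 2) ≤
        N * (G * B z * Q z) := by
      rw [iidExp_sum_sq hp (fun a => lo a z - L z)]
      · refine mul_le_mul_of_nonneg_left ?_ hN0.le
        have h1 : ∑ a, p a * (lo a z - L z) ^ 2 = ∑ a, p a * lo a z ^ 2 - L z ^ 2 := by
          have : ∀ a, p a * (lo a z - L z) ^ 2 =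
              p a * lo a z ^ 2 - 2 * L z * (p a * lo a z) + L z ^ 2 * p a := fun a => by ring
          simp only [this, Finset.sum_add_distrib, Finset.sum_sub_distrib, ← Finset.mul_sum, hp]
          change _ - 2 * L z * L z + _ = _
          ring
        have h2 : ∑ a, p a * lo a z ^ 2 ≤ G * B z * Q z := by
          rw [hQ, Finset.mul_sum]
          refine Finset.sum_le_sum fun a _ => ?_
          rw [mul_left_comm]
          exact mul_le_mul_of_nonneg_left (hloB a z) (hp0 a)
        nlinarith [sq_nonneg (L z)]
      · simp only [mul_sub, Finset.sum_sub_distrib, ← Finset.sum_mul, hp, one_mul]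
        exact sub_self _
    rcases (hB0 z).eq_or_lt with hz | hz
    · have hlo_zero : ∀ a, lo a z = 0 := fun a => by
        have := hloB a z
        rw [← hz, mul_zero, zero_mul] at this
        exact pow_eq_zero_iff (two_ne_zero) |>.1 (le_antisymm this (sq_nonneg _))
      have hL_zero : L z = 0 := by simp [hL, hlo_zero]
      simp only [hlo_zero, hL_zero, sub_zero, Finset.sum_const_zero, abs_zero, mul_zero]
      rw [iidExp_const hp]
      have := hQ0 z
      have := hB0 z
      positivity
    -- `E|u| ≤ √(E u²)` in the form of an AM-GM inequality with weight proportional to `B z`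
    · have hamgm : ∀ u : ℝ, 1 / N * |u| ≤ 1 / (2 * N ^ 2 * κ * B z) * u ^ 2 + κ * B z / 2 := by
        intro u
        have h1 : 1 / (2 * N ^ 2 * κ * B z) * u ^ 2 + κ * B z / 2 - 1 / N * |u| =
            (|u| - N * κ * B z) ^ 2 / (2 * N ^ 2 * κ * B z) := by
          rw [← sq_abs u]; field_simp; ring
        have h2 : 0 ≤ (|u| - N * κ * B z) ^ 2 / (2 * N ^ 2 * κ * B z) := by positivity
        linarith
      calc _ ≤ iidExp p (fun c : I → A => 1 / (2 * N ^ 2 * κ * B z) *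
              (∑ i, (lo (c i) z - L z)) ^ 2 + κ * B z / 2) :=
            iidExp_mono hp0 fun c => hamgm _
        _ ≤ 1 / (2 * N ^ 2 * κ * B z) * (N * (G * B z * Q z)) + κ * B z / 2 := by
            rw [iidExp_add, iidExp_const_mul, iidExp_const hp]
            gcongr
        _ = G / N * Q z / (2 * κ) + κ * B z / 2 := by field_simp
        _ ≤ κ ^ 2 * Q z / (2 * κ) + κ * B z / 2 := by
            have := hQ0 z
            gcongr
            rwa [div_le_iff₀ hN0]
        _ = κ * (Q z + B z) / 2 := by field_simp
  have hpt : ∀ (c : I → A) z, |1 / N * ∑ i, v (c i) z - Q z| ≤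
      1 / N * |∑ i, (lo (c i) z - L z)| + (1 / N * ∑ i, hi (c i) z + H z) := by
    intro c z
    have h1 : 1 / N * ∑ i, v (c i) z - Q z =
        1 / N * ∑ i, (lo (c i) z - L z) + (1 / N * ∑ i, hi (c i) z - H z) := by
      simp only [hsplit _ z, Finset.sum_add_distrib, Finset.sum_sub_distrib, Finset.sum_const,
        Finset.card_univ, nsmul_eq_mul, hQLH z, ← hN]
      field_simp
      ring
    rw [h1]
    refine (abs_add_le _ _).trans ?_
    rw [abs_mul, abs_of_pos (by positivity : 0 < 1 / N)]
    gcongr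
    have h2 : 0 ≤ 1 / N * ∑ i, hi (c i) z :=
      mul_nonneg (by positivity) (Finset.sum_nonneg fun i _ => hhi0 _ _)
    exact abs_le.2 ⟨by linarith [hH0 z], by linarith [hH0 z]⟩
  rw [iidExp_sum]
  have hz : ∀ z, iidExp p (fun c : I → A => |1 / N * ∑ i, v (c i) z - Q z|) ≤
      κ * (Q z + B z) / 2 + 2 * H z := by
    intro z
    refine (iidExp_mono hp0 fun c => hpt c z).trans ?_
    rw [iidExp_add, iidExp_add, iidExp_const hp, iidExp_const_mul (F := fun c => ∑ i, hi (c i) z),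
      iidExp_sum]
    simp only [iidExp_apply hp _ (fun a => hi a z), Finset.sum_const, Finset.card_univ,
      nsmul_eq_mul, ← hN]
    have h1 : 1 / N * (N * ∑ a, p a * hi a z) = H z := by simp only [hH]; field_simp
    linarith [htrunc z]
  refine (Finset.sum_le_sum fun z _ => hz z).trans (le_of_eq ?_)
  rw [Finset.sum_add_distrib, ← Finset.mul_sum, ← Finset.sum_div, ← Finset.mul_sum,
    Finset.sum_add_distrib, hQsum, hB]
  have h1 : ∑ z, H z = ∑ a, p a * ∑ z, hi a z := by
    simp only [hH, Finset.mul_sum]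
    exact Finset.sum_comm
  rw [h1]
  ring

/-! ### Divergence of product laws and of nearby laws -/

theorem klDivergence_prod {Z : Type*} [Fintype Z] {P Q : Z → ℝ} (hP : ∑ z, P z = 1)
    (hac : AbsCont P Q) (n : ℕ) :
    klDivergence (fun z : Fin n → Z => ∏ i, P (z i)) (fun z => ∏ i, Q (z i)) =
      n * klDivergence P Q := by
  have h1 : ∀ z : Fin n → Z, (∏ i, P (z i)) * Real.log ((∏ i, P (z i)) / ∏ i, Q (z i)) =
      (∏ i, P (z i)) * ∑ i, Real.log (P (z i) / Q (z i)) := by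
    intro z
    by_cases h : ∀ i, P (z i) ≠ 0
    · rw [← Finset.prod_div_distrib, Real.log_prod]
      exact fun i _ => div_ne_zero (h i) fun h0 => h i (hac _ h0)
    · push Not at h
      obtain ⟨i, hi⟩ := h
      have h0 : ∏ i, P (z i) = 0 := Finset.prod_eq_zero (Finset.mem_univ i) hi
      simp [h0]
  simp only [klDivergence, h1]
  have h2 := iidExp_sum (I := Fin n) Finset.univ P (fun i c => Real.log (P (c i) / Q (c i)))
  rw [iidExp_eq] at h2
  rw [h2]
  simp only [iidExp_apply hP _ (fun z => Real.log (P z / Q z)), Finset.sum_const, Finset.card_univ,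
    Fintype.card_fin, nsmul_eq_mul]

theorem abs_mul_log_sub_le {x a : ℝ} (hx : 0 ≤ x) (ha : 1 ≤ a) (hxa : x ≤ Real.exp a) :
    |x * Real.log x - (x - 1)| ≤ a * |x - 1| := by
  rcases hx.eq_or_lt with rfl | hx0
  · simpa using ha
  have hlow : x - 1 ≤ x * Real.log x := by
    have h1 := mul_le_mul_of_nonneg_left (Real.one_sub_inv_le_log_of_pos hx0) hx
    rwa [mul_sub, mul_inv_cancel₀ hx0.ne', mul_one] at h1
  rw [abs_of_nonneg (by linarith)]
  rcases le_total 1 x with h | h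
  · have h1 : Real.log x ≤ a := (Real.log_le_iff_le_exp hx0).2 hxa
    have h2 := Real.log_le_sub_one_of_pos hx0
    rw [abs_of_nonneg (by linarith)]
    nlinarith
  · have h1 := mul_nonpos_of_nonneg_of_nonpos hx (Real.log_nonpos hx h)
    rw [abs_of_nonpos (by linarith)]
    nlinarith

/-- Divergences from `B` of two laws with comparable densities differ by at most a multiple of
their `L¹` distance. -/
theorem abs_klDivergence_sub_le {Z : Type*} [Fintype Z] {P Q B : Z → ℝ} {a : ℝ} (ha : 1 ≤ a)
    (hP0 : ∀ z, 0 ≤ P z) (hQ0 : ∀ z, 0 ≤ Q z) (hB0 : ∀ z, 0 ≤ B z)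
    (hPQ : ∀ z, P z ≤ Real.exp a * Q z) (hQB : ∀ z, Q z ≤ Real.exp a * B z)
    (hBQ : ∀ z, B z ≤ Real.exp a * Q z) (hP : ∑ z, P z = 1) (hQ : ∑ z, Q z = 1) :
    |klDivergence P B - klDivergence Q B| ≤ 2 * a * ∑ z, |P z - Q z| := by
  have hz : ∀ z, |P z * Real.log (P z / B z) - Q z * Real.log (Q z / B z) - (P z - Q z)| ≤
      2 * a * |P z - Q z| := by
    intro z
    rcases (hQ0 z).eq_or_lt with h | hQz
    · have h1 : P z = 0 := le_antisymm (by simpa [← h] using hPQ z) (hP0 z)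
      simp [h1, ← h]
    have hBz : 0 < B z := by
      rcases (hB0 z).eq_or_lt with h | h
      · have := hQB z
        rw [← h, mul_zero] at this
        linarith
      · exact h
    have hlog : |Real.log (Q z / B z)| ≤ a := by
      refine abs_le.2 ⟨?_, ?_⟩
      · rw [Real.le_log_iff_exp_le (by positivity), le_div_iff₀ hBz, Real.exp_neg,
          inv_mul_le_iff₀ (Real.exp_pos a)]
        exact hBQ z
      · rw [Real.log_le_iff_le_exp (by positivity), div_le_iff₀ hBz]
        exact hQB z
    have hx := abs_mul_log_sub_le (x := P z / Q z) (div_nonneg (hP0 z) hQz.le) ha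
      (by rw [div_le_iff₀ hQz]; exact hPQ z)
    have hx2 : |P z * Real.log (P z / Q z) - (P z - Q z)| ≤ a * |P z - Q z| := by
      have h1 : P z * Real.log (P z / Q z) - (P z - Q z) =
          Q z * (P z / Q z * Real.log (P z / Q z) - (P z / Q z - 1)) := by field_simp
      have h2 : P z - Q z = Q z * (P z / Q z - 1) := by field_simp
      rw [h1, abs_mul, h2, abs_mul, abs_of_pos hQz, mul_left_comm]
      exact mul_le_mul_of_nonneg_left hx hQz.le
    have hdec : P z * Real.log (P z / B z) =
        P z * Real.log (P z / Q z) + P z * Real.log (Q z / B z) := by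
      rcases (hP0 z).eq_or_lt with h | h
      · simp [← h]
      · rw [← mul_add, ← Real.log_mul (by positivity) (by positivity)]
        congr 2
        field_simp
    rw [hdec]
    have h3 : P z * Real.log (P z / Q z) + P z * Real.log (Q z / B z) -
        Q z * Real.log (Q z / B z) - (P z - Q z) =
        (P z * Real.log (P z / Q z) - (P z - Q z)) + (P z - Q z) * Real.log (Q z / B z) := by
      ring
    rw [h3]
    refine (abs_add_le _ _).trans ?_
    rw [abs_mul (P z - Q z)]
    have := mul_le_mul_of_nonneg_left hlog (abs_nonneg (P z - Q z))
    linarith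
  have h4 : klDivergence P B - klDivergence Q B =
      ∑ z, (P z * Real.log (P z / B z) - Q z * Real.log (Q z / B z) - (P z - Q z)) := by
    simp only [Finset.sum_sub_distrib, hP, hQ, klDivergence]
    ring
  rw [h4, Finset.mul_sum]
  exact (Finset.abs_sum_le_sum_abs _ _).trans (Finset.sum_le_sum fun z _ => hz z)

theorem abs_one_add_mul_log_sub_le {u : ℝ} (hu : |u| ≤ 1 / 2) :
    |(1 + u) * Real.log (1 + u) - (u + u ^ 2 / 2)| ≤ 4 * |u| ^ 3 := by
  have h1 := Real.abs_log_sub_add_sum_range_le (x := -u) (by rw [abs_neg]; linarith) 2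
  simp only [Finset.sum_range_succ, Finset.sum_range_zero, abs_neg] at h1
  have h2 : |u| ^ (2 + 1) / (1 - |u|) ≤ 2 * |u| ^ 3 := by
    rw [div_le_iff₀ (by linarith)]
    have := mul_nonneg (pow_nonneg (abs_nonneg u) 3) (sub_nonneg.2 hu)
    rw [show 2 + 1 = 3 from rfl]
    linarith
  have h3 : (1 + u) * Real.log (1 + u) - (u + u ^ 2 / 2) =
      (1 + u) * (Real.log (1 + u) - u + u ^ 2 / 2) - u ^ 3 / 2 := by ring
  have h4 : |Real.log (1 + u) - u + u ^ 2 / 2| ≤ 2 * |u| ^ 3 := by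
    refine le_trans (le_of_eq ?_) (h1.trans h2)
    congr 1
    norm_num
    ring
  have h5 : |1 + u| ≤ 3 / 2 := (abs_add_le _ _).trans (by rw [abs_one]; linarith)
  rw [h3]
  refine (abs_sub _ _).trans ?_
  rw [abs_mul, abs_div, abs_pow, abs_two]
  have h6 := mul_le_mul h5 h4 (abs_nonneg _) (by norm_num)
  nlinarith [pow_nonneg (abs_nonneg u) 3]

/-! ### The warden's law under sparse independent inputs -/

section Warden

variable {Z : Type*} [Fintype Z]

/-- The output law of one channel use when the input symbol is `1` with probability `α`. -/
noncomputable def mixLaw (V : BDMC Z) (α : ℝ) (z : Z) : ℝ := ∑ a, bern α a * V.law a z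

theorem mixLaw_eq (V : BDMC Z) (α : ℝ) (z : Z) :
    mixLaw V α z = (1 - α) * V.law 0 z + α * V.law 1 z := by
  simp [mixLaw, bern]

theorem sum_mixLaw (V : BDMC Z) (α : ℝ) : ∑ z, mixLaw V α z = 1 := by
  simp only [mixLaw_eq, Finset.sum_add_distrib, ← Finset.mul_sum, V.sum_eq_one]
  ring

theorem iidExp_prodLaw (V : BDMC Z) (α : ℝ) {n : ℕ} (z : Fin n → Z) :
    iidExp (bern α) (fun x => V.prodLaw x z) = ∏ i, mixLaw V α (z i) :=
  iidExp_prod (bern α) (fun i a => V.law a (z i))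

theorem absCont_mixLaw {V : BDMC Z} (hV : AbsCont (V.law 1) (V.law 0)) (α : ℝ) :
    AbsCont (mixLaw V α) (V.law 0) := by
  intro z hz
  simp [mixLaw_eq, hz, hV z hz]

/-- The divergence of the sparse product law from the innocent one has the limit `t² χ² / 2`. -/
theorem tendsto_klDivergence_mixLaw {V : BDMC Z} (hV : AbsCont (V.law 1) (V.law 0)) (t : ℝ) :
    Tendsto (fun n : ℕ => klDivergence (fun z : Fin n → Z => ∏ i, mixLaw V (t / √(n : ℝ)) (z i))
      (innocentLaw V n)) atTop (𝓝 (t ^ 2 * chiSq (V.law 1) (V.law 0) / 2)) := by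
  have hprod : ∀ n : ℕ, klDivergence (fun z : Fin n → Z => ∏ i, mixLaw V (t / √(n : ℝ)) (z i))
      (innocentLaw V n) = n * klDivergence (mixLaw V (t / √(n : ℝ))) (V.law 0) := fun n =>
    klDivergence_prod (sum_mixLaw V _) (absCont_mixLaw hV _) n
  simp only [hprod]
  set g : Z → ℝ := fun z => (V.law 1 z - V.law 0 z) / V.law 0 z with hg
  have hmean : ∑ z, V.law 0 z * g z = 0 := by
    have : ∀ z, V.law 0 z * g z = V.law 1 z - V.law 0 z := by
      intro z
      by_cases h : V.law 0 z = 0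
      · simp [h, hV z h]
      · simp only [hg]; field_simp
    simp [this, V.sum_eq_one]
  have hvar : ∑ z, V.law 0 z * g z ^ 2 = chiSq (V.law 1) (V.law 0) := by
    refine Finset.sum_congr rfl fun z _ => ?_
    by_cases h : V.law 0 z = 0
    · simp [h]
    · simp only [hg]; field_simp
  have hkl : ∀ α, klDivergence (mixLaw V α) (V.law 0) =
      ∑ z, V.law 0 z * ((1 + α * g z) * Real.log (1 + α * g z)) := by
    intro α
    refine Finset.sum_congr rfl fun z _ => ?_
    by_cases h : V.law 0 z = 0
    · simp [h, mixLaw_eq, hV z h]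
    · have h1 : mixLaw V α z / V.law 0 z = 1 + α * g z := by
        rw [mixLaw_eq]; simp only [hg]; field_simp; ring
      have h2 : mixLaw V α z = V.law 0 z * (1 + α * g z) := by
        rw [← h1]; field_simp
      rw [h1, h2, mul_assoc]
  set S := ∑ z, |g z| with hS
  have hgS : ∀ z, |g z| ≤ S := fun z =>
    Finset.single_le_sum (f := fun z => |g z|) (fun z _ => abs_nonneg _) (Finset.mem_univ z)
  have hS0 : 0 ≤ S := Finset.sum_nonneg fun z _ => abs_nonneg _
  have hlim : Tendsto (fun n : ℕ => 4 * (|t| * S) ^ 3 / √(n : ℝ)) atTop (𝓝 0) :=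
    tendsto_sqrt_natCast.const_div_atTop _
  rw [tendsto_iff_norm_sub_tendsto_zero]
  refine squeeze_zero' (Eventually.of_forall fun _ => norm_nonneg _) ?_ hlim
  filter_upwards [tendsto_sqrt_natCast.eventually_ge_atTop (2 * (|t| * S) + 1)] with n hn
  set s := √(n : ℝ) with hs
  have hts : 0 ≤ |t| * S := by positivity
  have hs0 : 0 < s := by linarith
  have hns : (n : ℝ) = s * s := (Real.mul_self_sqrt (Nat.cast_nonneg n)).symm
  have hu : ∀ z, |t / s * g z| ≤ |t| * S / s := by
    intro z
    rw [abs_mul, abs_div, abs_of_pos hs0, div_mul_eq_mul_div]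
    gcongr
    exact hgS z
  have hu2 : |t| * S / s ≤ 1 / 2 := by rw [div_le_iff₀ hs0]; linarith
  have hrem : klDivergence (mixLaw V (t / s)) (V.law 0) -
      (t / s) ^ 2 * chiSq (V.law 1) (V.law 0) / 2 =
      ∑ z, V.law 0 z * ((1 + t / s * g z) * Real.log (1 + t / s * g z) -
        (t / s * g z + (t / s * g z) ^ 2 / 2)) := by
    have h1 : ∀ z, V.law 0 z * ((1 + t / s * g z) * Real.log (1 + t / s * g z) -
        (t / s * g z + (t / s * g z) ^ 2 / 2)) =
        V.law 0 z * ((1 + t / s * g z) * Real.log (1 + t / s * g z)) -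
        (t / s * (V.law 0 z * g z) + (t / s) ^ 2 / 2 * (V.law 0 z * g z ^ 2)) :=
      fun z => by ring
    simp only [h1, Finset.sum_sub_distrib, Finset.sum_add_distrib, ← Finset.mul_sum, hmean, hvar,
      hkl]
    ring
  have hbound : |klDivergence (mixLaw V (t / s)) (V.law 0) -
      (t / s) ^ 2 * chiSq (V.law 1) (V.law 0) / 2| ≤ 4 * (|t| * S / s) ^ 3 := by
    rw [hrem]
    refine (Finset.abs_sum_le_sum_abs _ _).trans ?_
    calc _ ≤ ∑ z, V.law 0 z * (4 * (|t| * S / s) ^ 3) := by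
          refine Finset.sum_le_sum fun z _ => ?_
          rw [abs_mul, abs_of_nonneg (V.nonneg 0 z)]
          refine mul_le_mul_of_nonneg_left ?_ (V.nonneg 0 z)
          refine (abs_one_add_mul_log_sub_le ((hu z).trans hu2)).trans ?_
          gcongr
          exact hu z
      _ = _ := by rw [← Finset.sum_mul, V.sum_eq_one, one_mul]
  have h5 : (n : ℝ) * klDivergence (mixLaw V (t / s)) (V.law 0) -
      t ^ 2 * chiSq (V.law 1) (V.law 0) / 2 =
      n * (klDivergence (mixLaw V (t / s)) (V.law 0) -
        (t / s) ^ 2 * chiSq (V.law 1) (V.law 0) / 2) := by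
    rw [hns]; field_simp
  rw [h5, Real.norm_eq_abs, abs_mul, abs_of_nonneg (Nat.cast_nonneg n)]
  calc (n : ℝ) * _ ≤ n * (4 * (|t| * S / s) ^ 3) := by gcongr
    _ = _ := by rw [hns]; field_simp

end Warden

/-! ### Random coding -/

section Coding

variable {Y Z : Type*} [Fintype Y] [Fintype Z] {n : ℕ}

/-- The number of symbols `1` in `x`, as a real number. -/
noncomputable def weight (x : Fin n → Fin 2) : ℝ := ∑ i, if x i = 1 then 1 else 0

/-- The conditional probability, given the input `x`, that the pulse sum of `h` exceeds its typical
value `t √n * E_{W(·|1)} h` by at least `ε √n`. -/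
noncomputable def upperDev (W : BDMC Y) (h : Y → ℝ) (t ε : ℝ) (x : Fin n → Fin 2) : ℝ :=
  tailProb W h x ((t * ∑ b, W.law 1 b * h b + ε) * √(n : ℝ))

theorem abs_weight_sub_lt (W : BDMC Y) {t ε : ℝ} {x : Fin n → Fin 2}
    (h : upperDev W (fun _ => 1) t ε x + upperDev W (fun _ => -1) t ε x < 1) :
    |weight x - t * √(n : ℝ)| < ε * √(n : ℝ) := by
  have h1 : ∀ y : Fin n → Y, pulseSum (fun _ => 1) x y = weight x := fun _ => rfl
  have h2 : ∀ y : Fin n → Y, pulseSum (fun _ => -1) x y = -weight x := fun y => by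
    rw [pulseSum_neg (fun _ => 1), h1]
  have h3 := tailProb_nonneg W (fun _ => 1) x ((t * ∑ b, W.law 1 b * 1 + ε) * √(n : ℝ))
  have h4 := tailProb_nonneg W (fun _ => -1) x ((t * ∑ b, W.law 1 b * -1 + ε) * √(n : ℝ))
  simp only [upperDev] at h
  simp only [tailProb, h1, h2, ← Finset.sum_mul, W.sum_prodLaw, W.sum_eq_one] at h h3 h4
  rw [abs_lt]
  constructor
  · by_contra! h5
    rw [if_pos (show (t * (1 * -1) + ε) * √(n : ℝ) ≤ -weight x by linarith)] at h
    linarith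
  · by_contra! h5
    rw [if_pos (show (t * (1 * 1) + ε) * √(n : ℝ) ≤ weight x by linarith)] at h
    linarith

/-- The score of the pair `p = (m, k)` in a codebook: a bound on the probability of an atypical
codeword or output plus a union bound, at threshold `exp (β √n)`, on the probability that another
codeword with the same key is favoured. -/
noncomputable def pairScore (W : BDMC Y) (h : Y → ℝ) (t ε β : ℝ) {M K : ℕ}
    (c : Fin M × Fin K → Fin n → Fin 2) (p : Fin M × Fin K) : ℝ :=
  upperDev W (fun _ => 1) t ε (c p) + upperDev W (fun _ => -1) t ε (c p) +
    upperDev W (fun b => -h b) t ε (c p) +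
    Real.exp (-(β * √(n : ℝ))) * ∑ m' ∈ Finset.univ.erase p.1,
      ∑ y, W.prodLaw (c p) y * Real.exp (pulseSum h (c (m', p.2)) y)

theorem upperDev_nonneg (W : BDMC Y) (h : Y → ℝ) (t ε : ℝ) (x : Fin n → Fin 2) :
    0 ≤ upperDev W h t ε x := tailProb_nonneg _ _ _ _

theorem sum_prodLaw_mul_exp_nonneg (W : BDMC Y) (h : Y → ℝ) (x x' : Fin n → Fin 2) :
    0 ≤ ∑ y, W.prodLaw x y * Real.exp (pulseSum h x' y) :=
  Finset.sum_nonneg fun y _ => mul_nonneg (W.prodLaw_nonneg x y) (Real.exp_pos _).le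

theorem pairScore_nonneg (W : BDMC Y) (h : Y → ℝ) (t ε β : ℝ) {M K : ℕ}
    (c : Fin M × Fin K → Fin n → Fin 2) (p : Fin M × Fin K) : 0 ≤ pairScore W h t ε β c p := by
  unfold pairScore
  have h1 := upperDev_nonneg W (fun _ => 1) t ε (c p)
  have h2 := upperDev_nonneg W (fun _ => -1) t ε (c p)
  have h3 := upperDev_nonneg W (fun b => -h b) t ε (c p)
  have h4 : 0 ≤ ∑ m' ∈ Finset.univ.erase p.1,
      ∑ y, W.prodLaw (c p) y * Real.exp (pulseSum h (c (m', p.2)) y) :=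
    Finset.sum_nonneg fun m' _ => sum_prodLaw_mul_exp_nonneg W h _ _
  positivity

theorem iidExp_pairScore_le (W : BDMC Y) (h : Y → ℝ) (hh : ∑ b, W.law 0 b * Real.exp (h b) = 1)
    {t : ℝ} (ht : 0 < t) (hn : t ≤ √(n : ℝ)) (ε β : ℝ) {M K : ℕ} {ρ : ℝ}
    (hM : (M : ℝ) - 1 ≤ Real.exp (ρ * √(n : ℝ))) (p : Fin M × Fin K) :
    iidExp (fun x : Fin n → Fin 2 => ∏ i, bern (t / √(n : ℝ)) (x i))
      (fun c : Fin M × Fin K → Fin n → Fin 2 => pairScore W h t ε β c p) ≤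
    iidExp (I := Fin n) (bern (t / √(n : ℝ))) (upperDev W (fun _ => 1) t ε) +
    iidExp (I := Fin n) (bern (t / √(n : ℝ))) (upperDev W (fun _ => -1) t ε) +
    iidExp (I := Fin n) (bern (t / √(n : ℝ))) (upperDev W (fun b => -h b) t ε) +
    Real.exp (t ^ 2 * ∑ b, W.law 1 b * Real.exp (h b)) * Real.exp (-(β - ρ) * √(n : ℝ)) := by
  set P : (Fin n → Fin 2) → ℝ := fun x => ∏ i, bern (t / √(n : ℝ)) (x i) with hP
  have hP1 : ∑ x, P x = 1 := by
    have := iidExp_one (I := Fin n) (sum_bern (t / √(n : ℝ)))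
    rw [iidExp_eq] at this
    simpa using this
  have hPE : ∀ f : (Fin n → Fin 2) → ℝ, ∑ x, P x * f x = iidExp (bern (t / √(n : ℝ))) f :=
    fun f => (iidExp_eq _ _).symm
  unfold pairScore
  rw [iidExp_add, iidExp_add, iidExp_add, iidExp_const_mul, iidExp_sum]
  rw [iidExp_apply hP1 p (upperDev W (fun _ => 1) t ε),
    iidExp_apply hP1 p (upperDev W (fun _ => -1) t ε),
    iidExp_apply hP1 p (upperDev W (fun b => -h b) t ε)]
  simp only [hPE]
  have hT := iidExp_cross_exp_pulseSum_le W h hh ht hn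
  have hcross : ∀ m' ∈ Finset.univ.erase p.1,
      iidExp P (fun c : Fin M × Fin K → Fin n → Fin 2 =>
        ∑ y, W.prodLaw (c p) y * Real.exp (pulseSum h (c (m', p.2)) y)) ≤
      Real.exp (t ^ 2 * ∑ b, W.law 1 b * Real.exp (h b)) := by
    intro m' hm'
    have hne : p ≠ (m', p.2) := fun h0 =>
      (Finset.mem_erase.1 hm').1 (by rw [h0])
    rw [iidExp_apply_apply hP1 hne
      (fun x x' => ∑ y, W.prodLaw x y * Real.exp (pulseSum h x' y))]
    simp only [hPE]
    exact hT
  have hsum := Finset.sum_le_card_nsmul _ _ _ hcross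
  rw [Finset.card_erase_of_mem (Finset.mem_univ _), Finset.card_univ, Fintype.card_fin,
    nsmul_eq_mul, Nat.cast_sub (Nat.succ_le_of_lt (Fin.pos p.1)), Nat.cast_one] at hsum
  refine add_le_add le_rfl ?_
  calc _ ≤ Real.exp (-(β * √(n : ℝ))) *
        (Real.exp (ρ * √(n : ℝ)) * Real.exp (t ^ 2 * ∑ b, W.law 1 b * Real.exp (h b))) := by
        refine mul_le_mul_of_nonneg_left (hsum.trans ?_) (Real.exp_pos _).le
        exact mul_le_mul_of_nonneg_right hM (Real.exp_pos _).le
    _ = _ := by rw [← Real.exp_add, ← Real.exp_add, ← Real.exp_add]; ring_nf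

theorem sum_prodLaw_of_large_le_tailProb {V : BDMC Z} (hV : AbsCont (V.law 1) (V.law 0))
    (x : Fin n → Fin 2) (γ : ℝ) :
    ∑ z, (if Real.exp γ * innocentLaw V n z < V.prodLaw x z then V.prodLaw x z else 0) ≤
      tailProb V (fun b => Real.log (V.law 1 b / V.law 0 b)) x γ := by
  refine Finset.sum_le_sum fun z _ => ?_
  by_cases hz : V.prodLaw x z = 0
  · simp [hz]
  have hfac : ∀ i, V.law (x i) (z i) ≠ 0 := fun i h0 =>
    hz (Finset.prod_eq_zero (Finset.mem_univ i) h0)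
  have hfac0 : ∀ i, 0 < V.law 0 (z i) := by
    intro i
    refine (V.nonneg _ _).lt_of_ne' fun h0 => hfac i ?_
    rcases Fin.exists_fin_two.1 ⟨x i, rfl⟩ with h1 | h1
    · rw [h1, h0]
    · rw [h1, hV _ h0]
  have hden : V.prodLaw x z = innocentLaw V n z *
      Real.exp (pulseSum (fun b => Real.log (V.law 1 b / V.law 0 b)) x z) := by
    rw [exp_pulseSum, innocentLaw, ← Finset.prod_mul_distrib]
    refine Finset.prod_congr rfl fun i _ => ?_
    split_ifs with h1
    · have h2 := hfac i
      rw [h1] at h2 ⊢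
      rw [Real.exp_log (div_pos ((V.nonneg _ _).lt_of_ne' h2) (hfac0 i))]
      have := (hfac0 i).ne'
      field_simp
    · rw [show x i = 0 by omega, mul_one]
  have hB : 0 < innocentLaw V n z := Finset.prod_pos fun i _ => hfac0 i
  split_ifs with h1 h2
  · rw [mul_one]
  · exfalso
    push Not at h2
    rw [hden, mul_comm] at h1
    exact absurd (lt_of_mul_lt_mul_left h1 hB.le) (not_lt.2 (Real.exp_le_exp.2 h2.le))
  · rw [mul_one]; exact V.prodLaw_nonneg x z
  · simp

/-- Random coding: codebooks with `M * K ≥ exp (σ √n)` words and `M ≲ exp (ρ √n)` messages per key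
exist for which the mean score and the `L¹` distance of the warden's law from the sparse product
law are exponentially small, as soon as `ρ < β` and `σ > t D(Q_1 ‖ Q_0)`. -/
theorem exists_codebook (W : BDMC Y) (h : Y → ℝ) (hh : ∑ b, W.law 0 b * Real.exp (h b) = 1)
    {V : BDMC Z} (hV : AbsCont (V.law 1) (V.law 0)) {t ε β ρ σ : ℝ} (ht : 0 < t) (hε : 0 < ε)
    (hβ : ρ < β) (hσ : t * klDivergence (V.law 1) (V.law 0) < σ) :
    ∃ r > 0, ∀ᶠ n : ℕ in atTop, ∀ M K : ℕ, 0 < M → 0 < K →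
      (M : ℝ) - 1 ≤ Real.exp (ρ * √(n : ℝ)) → Real.exp (σ * √(n : ℝ)) ≤ M * K →
      ∃ c : Fin M × Fin K → Fin n → Fin 2,
        1 / ((M : ℝ) * K) * ∑ p, pairScore W h t ε β c p +
          ∑ z, |1 / ((M : ℝ) * K) * ∑ p, V.prodLaw (c p) z - ∏ i, mixLaw V (t / √(n : ℝ)) (z i)| ≤
        Real.exp (-r * √(n : ℝ)) := by
  set D := klDivergence (V.law 1) (V.law 0) with hD
  set e := (σ - t * D) / 2 with he
  have he0 : 0 < e := by linarith
  set lr : Z → ℝ := fun b => Real.log (V.law 1 b / V.law 0 b) with hlr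
  have hsmall := ((((isExpSmall_tailProb W (fun _ => 1) ht hε).add
    (isExpSmall_tailProb W (fun _ => -1) ht hε)).add
    (isExpSmall_tailProb W (fun b => -h b) ht hε)).add
    (isExpSmall_const_mul_exp (Real.exp (t ^ 2 * ∑ b, W.law 1 b * Real.exp (h b)))
      (sub_pos.2 hβ))).add
    (((isExpSmall_tailProb V lr ht he0).const_mul zero_le_two).add
      (isExpSmall_const_mul_exp 1 (half_pos he0)))
  obtain ⟨r, hr, hsmall⟩ := hsmall
  refine ⟨r, hr, ?_⟩
  filter_upwards [hsmall, tendsto_sqrt_natCast.eventually_ge_atTop t] with n hn htn M K hM hK hMρ hMK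
  have hs0 : 0 < √(n : ℝ) := ht.trans_le htn
  have hα0 : 0 ≤ t / √(n : ℝ) := by positivity
  have hα1 : t / √(n : ℝ) ≤ 1 := by rwa [div_le_one hs0]
  set P : (Fin n → Fin 2) → ℝ := fun x => ∏ i, bern (t / √(n : ℝ)) (x i) with hP
  have hP0 : ∀ x, 0 ≤ P x := fun x => Finset.prod_nonneg fun i _ => bern_nonneg hα0 hα1 _
  have hP1 : ∑ x, P x = 1 := by
    have := iidExp_one (I := Fin n) (sum_bern (t / √(n : ℝ)))
    rw [iidExp_eq] at this
    simpa using this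
  have hPE : ∀ f : (Fin n → Fin 2) → ℝ, ∑ x, P x * f x = iidExp (bern (t / √(n : ℝ))) f :=
    fun f => (iidExp_eq _ _).symm
  refine exists_le_of_iidExp_le hP0 hP1 (le_trans ?_ hn)
  rw [iidExp_add, iidExp_const_mul, iidExp_sum]
  have hMK0 : (0 : ℝ) < M * K := by positivity
  refine add_le_add ?_ ?_
  · have h1 := Finset.sum_le_card_nsmul Finset.univ _ _ fun (p : Fin M × Fin K) _ =>
      iidExp_pairScore_le W h hh ht htn ε β hMρ p
    rw [Finset.card_univ, Fintype.card_prod, Fintype.card_fin, Fintype.card_fin, nsmul_eq_mul,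
      Nat.cast_mul] at h1
    rw [one_div, inv_mul_le_iff₀ hMK0]
    exact h1
  · have : Nonempty (Fin M × Fin K) := ⟨(⟨0, hM⟩, ⟨0, hK⟩)⟩
    have h1 := iidExp_soft_covering (I := Fin M × Fin K) hP0 hP1
      (v := fun x z => V.prodLaw x z) (fun x z => V.prodLaw_nonneg x z)
      (fun x => V.sum_prodLaw x) (B := innocentLaw V n)
      (fun z => Finset.prod_nonneg fun i _ => V.nonneg _ _)
      (by simpa [BDMC.prodLaw, innocentLaw] using V.sum_prodLaw (fun _ : Fin n => 0))
      (G := Real.exp ((t * ∑ b, V.law 1 b * lr b + e) * √(n : ℝ)))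
      (κ := Real.exp (-(e / 2) * √(n : ℝ))) (Real.exp_pos _).le (Real.exp_pos _) (by
        rw [Fintype.card_prod, Fintype.card_fin, Fintype.card_fin, Nat.cast_mul]
        refine le_trans (le_of_eq ?_) (mul_le_mul_of_nonneg_left hMK (by positivity))
        rw [← Real.exp_nat_mul, ← Real.exp_add]
        congr 1
        have : ∑ b, V.law 1 b * lr b = D := rfl
        rw [this, he]
        push_cast
        ring)
    simp only [hPE, iidExp_prodLaw, Fintype.card_prod, Fintype.card_fin, Nat.cast_mul] at h1
    refine h1.trans ?_
    rw [one_mul]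
    gcongr
    exact iidExp_mono (bern_nonneg hα0 hα1) fun x => sum_prodLaw_of_large_le_tailProb hV x _

/-! ### Decoding with the metric `q` -/

/-- The score `s log (q(1,b)/q(0,b))` of an output letter, normalised so that its exponential has
mean `1` under the innocent output law. -/
noncomputable def letterScore (q : Fin 2 → Y → ℝ) (W : BDMC Y) (s : ℝ) (b : Y) : ℝ :=
  Real.log (q 1 b ^ s / q 0 b ^ s) - Real.log (∑ y, W.law 0 y * (q 1 y ^ s / q 0 y ^ s))

theorem sum_law_zero_mul_pos (W : BDMC Y) {f : Y → ℝ} (hf : ∀ y, 0 < f y) :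
    0 < ∑ y, W.law 0 y * f y := by
  have h0 : ∃ y, W.law 0 y ≠ 0 := by
    by_contra! h
    have := W.sum_eq_one 0
    simp [h] at this
  obtain ⟨y, hy⟩ := h0
  exact Finset.sum_pos' (fun y _ => mul_nonneg (W.nonneg _ _) (hf y).le)
    ⟨y, Finset.mem_univ y, mul_pos ((W.nonneg _ _).lt_of_ne' hy) (hf y)⟩

theorem sum_law_zero_mul_exp_letterScore {q : Fin 2 → Y → ℝ} (hq : ∀ x y, 0 < q x y) (W : BDMC Y)
    (s : ℝ) : ∑ b, W.law 0 b * Real.exp (letterScore q W s b) = 1 := by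
  have hr : ∀ y, 0 < q 1 y ^ s / q 0 y ^ s := fun y =>
    div_pos (Real.rpow_pos_of_pos (hq _ _) _) (Real.rpow_pos_of_pos (hq _ _) _)
  have hpos := sum_law_zero_mul_pos W hr
  simp only [letterScore, Real.exp_sub, Real.exp_log hpos, Real.exp_log (hr _)]
  simp only [mul_div_assoc' (W.law 0 _) (q 1 _ ^ s / q 0 _ ^ s) (∑ y, _)]
  rw [← Finset.sum_div, div_self hpos.ne']

theorem sum_law_one_mul_letterScore (q : Fin 2 → Y → ℝ) (W : BDMC Y) (s : ℝ) :
    ∑ b, W.law 1 b * letterScore q W s b = rateFun q W s := by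
  simp only [letterScore, mul_sub, Finset.sum_sub_distrib, ← Finset.sum_mul, W.sum_eq_one, one_mul,
    rateFun]

/-- Comparing metrics amounts to comparing letter scores, up to a multiple of the weights. -/
theorem pulseSum_letterScore_add_le {q : Fin 2 → Y → ℝ} (hq : ∀ x y, 0 < q x y) (W : BDMC Y)
    {s : ℝ} (hs : 0 ≤ s) {x x' : Fin n → Fin 2} {y : Fin n → Y}
    (h : prodMetric q x y ≤ prodMetric q x' y) :
    pulseSum (letterScore q W s) x y +
        Real.log (∑ y, W.law 0 y * (q 1 y ^ s / q 0 y ^ s)) * weight x ≤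
      pulseSum (letterScore q W s) x' y +
        Real.log (∑ y, W.law 0 y * (q 1 y ^ s / q 0 y ^ s)) * weight x' := by
  have key : ∀ x : Fin n → Fin 2, pulseSum (letterScore q W s) x y +
      Real.log (∑ y, W.law 0 y * (q 1 y ^ s / q 0 y ^ s)) * weight x =
      s * (Real.log (prodMetric q x y) - ∑ i, Real.log (q 0 (y i))) := by
    intro x
    rw [prodMetric, Real.log_prod (fun i _ => (hq _ _).ne'), ← Finset.sum_sub_distrib,
      Finset.mul_sum, pulseSum, weight, Finset.mul_sum, ← Finset.sum_add_distrib]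
    refine Finset.sum_congr rfl fun i _ => ?_
    split_ifs with h1
    · rw [h1, letterScore, Real.log_div (Real.rpow_pos_of_pos (hq _ _) _).ne'
        (Real.rpow_pos_of_pos (hq _ _) _).ne', Real.log_rpow (hq _ _), Real.log_rpow (hq _ _)]
      ring
    · rw [show x i = 0 by omega]
      ring
  rw [key, key]
  have hpos : 0 < prodMetric q x y := Finset.prod_pos fun i _ => hq _ _
  have := Real.log_le_log hpos h
  gcongr

/-- If all codewords have nearly the weight `t √n`, then errors are atypical or overcome a threshold
just below `exp (t √n * rateFun q W s)`. -/
theorem errProb_le {q : Fin 2 → Y → ℝ} (hq : ∀ x y, 0 < q x y) (W : BDMC Y) {s : ℝ} (hs : 0 ≤ s)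
    {t ε β : ℝ} (C : Code n)
    (hβ : β ≤ t * rateFun q W s -
      ε * (1 + 2 * |Real.log (∑ y, W.law 0 y * (q 1 y ^ s / q 0 y ^ s))|))
    (hC : ∀ m k, |weight (C.word m k) - t * √(n : ℝ)| < ε * √(n : ℝ))
    (m : Fin C.numMsg) (k : Fin C.numKey) :
    errProb q W C m k ≤ upperDev W (fun b => -letterScore q W s b) t ε (C.word m k) +
      Real.exp (-(β * √(n : ℝ))) * ∑ m' ∈ Finset.univ.erase m,
        ∑ y, W.prodLaw (C.word m k) y *
          Real.exp (pulseSum (letterScore q W s) (C.word m' k) y) := by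
  set l := Real.log (∑ y, W.law 0 y * (q 1 y ^ s / q 0 y ^ s)) with hl
  set h := letterScore q W s with hh
  rw [Finset.sum_comm, Finset.mul_sum, upperDev, tailProb, ← Finset.sum_add_distrib, errProb]
  refine Finset.sum_le_sum fun y _ => ?_
  have hw := W.prodLaw_nonneg (C.word m k) y
  have hsum0 : 0 ≤ Real.exp (-(β * √(n : ℝ))) * ∑ m' ∈ Finset.univ.erase m,
      W.prodLaw (C.word m k) y * Real.exp (pulseSum h (C.word m' k) y) :=
    mul_nonneg (Real.exp_pos _).le
      (Finset.sum_nonneg fun m' _ => mul_nonneg hw (Real.exp_pos _).le)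
  split_ifs with h1 h2 h2
  · linarith
  · obtain ⟨m', hm', hle⟩ := h1
    have h3 := pulseSum_letterScore_add_le hq W hs hle
    rw [pulseSum_neg] at h2
    simp only [mul_neg, Finset.sum_neg_distrib] at h2
    rw [hh, sum_law_one_mul_letterScore, ← hh] at h2
    push Not at h2
    have h4 : l * (weight (C.word m' k) - weight (C.word m k)) ≤ |l| * (2 * (ε * √(n : ℝ))) := by
      refine (le_abs_self _).trans ?_
      rw [abs_mul]
      gcongr
      have h5 := abs_lt.1 (hC m k)
      have h6 := abs_lt.1 (hC m' k)
      exact abs_le.2 ⟨by linarith, by linarith⟩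
    have h7 : β * √(n : ℝ) ≤ pulseSum h (C.word m' k) y := by
      have h8 := mul_le_mul_of_nonneg_right hβ (Real.sqrt_nonneg (n : ℝ))
      nlinarith
    have h9 := Finset.single_le_sum
      (f := fun m' => W.prodLaw (C.word m k) y * Real.exp (pulseSum h (C.word m' k) y))
      (fun m' _ => mul_nonneg hw (Real.exp_pos _).le)
      (Finset.mem_erase.2 ⟨hm', Finset.mem_univ m'⟩)
    rw [mul_zero, zero_add]
    refine le_trans ?_ (mul_le_mul_of_nonneg_left h9 (Real.exp_pos _).le)
    rw [mul_left_comm, ← Real.exp_add]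
    exact le_mul_of_one_le_right hw (Real.one_le_exp (by linarith))
  · rw [mul_one]; linarith
  · rw [mul_zero]; linarith

end Coding

/-! ### Expurgation -/

/-- If the mean of nonnegative scores on a rectangle is at most `ζ³`, then dropping a fraction of at
most `ζ` of the columns and of the entries of every remaining column leaves only scores of at most
`ζ`. -/
theorem exists_expurgation {M K : ℕ} (hM : 0 < M) (hK : 0 < K) (S : Fin M × Fin K → ℝ)
    (hS0 : ∀ p, 0 ≤ S p) {ζ : ℝ} (hζ0 : 0 < ζ) (hζ : ζ ≤ 1 / 2)
    (hS : 1 / ((M : ℝ) * K) * ∑ p, S p ≤ ζ ^ 3) :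
    ∃ (M' K' : ℕ) (f : Fin K' → Fin K) (g : Fin K' → Fin M' → Fin M),
      f.Injective ∧ (∀ k, (g k).Injective) ∧ (∀ m k, S (g k m, f k) ≤ ζ) ∧
      0 < M' ∧ 0 < K' ∧ (M : ℝ) ≤ 2 * M' ∧ K' ≤ K ∧
      (1 - 2 * ζ) * (M * K) ≤ (M' : ℝ) * K' := by
  classical
  have hM0 : (0 : ℝ) < M := by exact_mod_cast hM
  have hK0 : (0 : ℝ) < K := by exact_mod_cast hK
  set good : Fin K → Finset (Fin M) := fun k => Finset.univ.filter fun m => S (m, k) ≤ ζ with hgood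
  set bad : Fin K → Finset (Fin M) := fun k => Finset.univ.filter fun m => ¬ S (m, k) ≤ ζ with hbad
  have hcard : ∀ k, ((good k).card : ℝ) + (bad k).card = M := by
    intro k
    have := Finset.card_filter_add_card_filter_not (s := (Finset.univ : Finset (Fin M)))
      (fun m => S (m, k) ≤ ζ)
    rw [Finset.card_univ, Fintype.card_fin] at this
    exact_mod_cast this
  set T : Finset (Fin K) := Finset.univ.filter fun k => ((bad k).card : ℝ) ≤ ζ * M with hT
  set U : Finset (Fin K) := Finset.univ.filter fun k => ¬ ((bad k).card : ℝ) ≤ ζ * M with hU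
  have hTU : (T.card : ℝ) + U.card = K := by
    have := Finset.card_filter_add_card_filter_not (s := (Finset.univ : Finset (Fin K)))
      (fun k => ((bad k).card : ℝ) ≤ ζ * M)
    rw [Finset.card_univ, Fintype.card_fin] at this
    exact_mod_cast this
  have hcol : ∀ k, ((bad k).card : ℝ) * ζ ≤ ∑ m, S (m, k) := by
    intro k
    calc ((bad k).card : ℝ) * ζ = ∑ m ∈ bad k, ζ := by simp
      _ ≤ ∑ m ∈ bad k, S (m, k) := Finset.sum_le_sum fun m hm =>
          (not_le.1 (Finset.mem_filter.1 hm).2).le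
      _ ≤ ∑ m, S (m, k) := Finset.sum_le_sum_of_subset_of_nonneg (Finset.subset_univ _)
          fun m _ _ => hS0 _
  have hall : (U.card : ℝ) * (ζ * M * ζ) ≤ ζ ^ 3 * (M * K) := by
    calc (U.card : ℝ) * (ζ * M * ζ) = ∑ k ∈ U, ζ * M * ζ := by simp
      _ ≤ ∑ k ∈ U, ((bad k).card : ℝ) * ζ := Finset.sum_le_sum fun k hk =>
          mul_le_mul_of_nonneg_right (not_le.1 (Finset.mem_filter.1 hk).2).le hζ0.le
      _ ≤ ∑ k, ((bad k).card : ℝ) * ζ := Finset.sum_le_sum_of_subset_of_nonneg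
          (Finset.subset_univ _) fun m _ _ => by positivity
      _ ≤ ∑ k, ∑ m, S (m, k) := Finset.sum_le_sum fun k _ => hcol k
      _ = ∑ p, S p := (Fintype.sum_prod_type_right _).symm
      _ ≤ ζ ^ 3 * (M * K) := by
          rwa [one_div, inv_mul_le_iff₀ (by positivity), mul_comm] at hS
  have hUK : (U.card : ℝ) ≤ ζ * K := by
    have h1 : (U.card : ℝ) * (ζ ^ 2 * M) ≤ ζ * K * (ζ ^ 2 * M) := by nlinarith
    exact le_of_mul_le_mul_right h1 (by positivity)
  set d := ⌊ζ * M⌋₊ with hd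
  have hdM : (d : ℝ) ≤ ζ * M := Nat.floor_le (by positivity)
  have hdM' : d ≤ M := by
    have : (d : ℝ) ≤ M := by nlinarith
    exact_mod_cast this
  have hM' : ((M - d : ℕ) : ℝ) = M - d := Nat.cast_sub hdM'
  have hgoodcard : ∀ k ∈ T, M - d ≤ (good k).card := by
    intro k hk
    have h1 : (bad k).card ≤ d := Nat.le_floor (Finset.mem_filter.1 hk).2
    have h2 : (good k).card + (bad k).card = M := by exact_mod_cast hcard k
    omega
  have hfT : ∀ k : Fin T.card, T.orderEmbOfFin rfl k ∈ T := Finset.orderEmbOfFin_mem T rfl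
  have hsub : ∀ k : Fin T.card, ∃ A ⊆ good (T.orderEmbOfFin rfl k), A.card = M - d :=
    fun k => Finset.exists_subset_card_eq (hgoodcard _ (hfT k))
  choose A hA hAcard using hsub
  refine ⟨M - d, T.card, T.orderEmbOfFin rfl, fun k => (A k).orderEmbOfFin (hAcard k),
    (T.orderEmbOfFin rfl).injective, fun k => ((A k).orderEmbOfFin (hAcard k)).injective,
    ?_, ?_, ?_, ?_, ?_, ?_⟩
  · intro m k
    exact (Finset.mem_filter.1 (hA k (Finset.orderEmbOfFin_mem (A k) (hAcard k) m))).2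
  · have : (0 : ℝ) < (M - d : ℕ) := by rw [hM']; nlinarith
    exact_mod_cast this
  · have : (0 : ℝ) < T.card := by nlinarith
    exact_mod_cast this
  · rw [hM']; nlinarith
  · simpa using Finset.card_le_univ T
  · rw [hM']
    have h1 : (1 - ζ) * M ≤ (M : ℝ) - d := by linarith
    have h2 : (1 - ζ) * K ≤ (T.card : ℝ) := by linarith
    have h3 := mul_le_mul h1 h2 (by nlinarith) (by nlinarith)
    nlinarith [mul_pos hM0 hK0, sq_nonneg ζ, mul_nonneg (sq_nonneg ζ) (mul_pos hM0 hK0).le]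

/-- Averaging mass functions over most of an index set instead of all of it changes the average
little in `L¹`. -/
theorem sum_abs_avg_sub_avg_le {A B Z : Type*} [Fintype A] [Fintype B] [Nonempty B] [Fintype Z]
    {v : A → Z → ℝ} (hv0 : ∀ a z, 0 ≤ v a z) (hv : ∀ a, ∑ z, v a z = 1) {e : B → A}
    (he : e.Injective) {ν : ℝ} (hν : (1 - ν) * Fintype.card A ≤ Fintype.card B) :
    ∑ z, |1 / (Fintype.card B : ℝ) * ∑ b, v (e b) z - 1 / (Fintype.card A : ℝ) * ∑ a, v a z| ≤
      2 * ν := by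
  classical
  set a : ℝ := (Fintype.card A : ℝ) with ha
  set b : ℝ := (Fintype.card B : ℝ) with hb
  have hb0 : 0 < b := by rw [hb]; exact_mod_cast Fintype.card_pos
  have hba : b ≤ a := by rw [ha, hb]; exact_mod_cast Fintype.card_le_of_injective e he
  have ha0 : 0 < a := hb0.trans_le hba
  set R : Z → ℝ := fun z => ∑ x ∈ (Finset.univ.image e)ᶜ, v x z with hR
  have hR0 : ∀ z, 0 ≤ R z := fun z => Finset.sum_nonneg fun x _ => hv0 x z
  have hsplit : ∀ z, ∑ x, v x z = ∑ y, v (e y) z + R z := by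
    intro z
    rw [← Finset.sum_add_sum_compl (Finset.univ.image e), Finset.sum_image fun x _ y _ h => he h]
  have hinv : 0 ≤ 1 / b - 1 / a := sub_nonneg.2 (one_div_le_one_div_of_le hb0 hba)
  have hz : ∀ z, |1 / b * ∑ y, v (e y) z - 1 / a * ∑ x, v x z| ≤
      (1 / b - 1 / a) * ∑ y, v (e y) z + 1 / a * R z := by
    intro z
    have h1 : 0 ≤ ∑ y, v (e y) z := Finset.sum_nonneg fun y _ => hv0 _ z
    have h2 : 0 ≤ (1 / b - 1 / a) * ∑ y, v (e y) z := mul_nonneg hinv h1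
    have h3 : 0 ≤ 1 / a * R z := mul_nonneg (by positivity) (hR0 z)
    rw [hsplit z]
    exact abs_le.2 ⟨by linarith, by linarith⟩
  refine (Finset.sum_le_sum fun z _ => hz z).trans ?_
  have hB : ∑ z, ∑ y, v (e y) z = b := by
    rw [Finset.sum_comm]; simp [hv, hb]
  have hRsum : ∑ z, R z = a - b := by
    have h1 : ∑ z, ∑ x, v x z = a := by rw [Finset.sum_comm]; simp [hv, ha]
    simp only [hsplit, Finset.sum_add_distrib, hB] at h1
    linarith
  rw [Finset.sum_add_distrib, ← Finset.mul_sum, ← Finset.mul_sum, hB, hRsum]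
  have h1 : (1 / b - 1 / a) * b + 1 / a * (a - b) = 2 * (a - b) / a := by field_simp; ring
  rw [h1, div_le_iff₀ ha0]
  linarith

/-! ### Expurgated random codes -/

section Existence

variable {Y Z : Type*} [Fintype Y] [Fintype Z]

theorem errProb_nonneg (q : Fin 2 → Y → ℝ) (W : BDMC Y) {n : ℕ} (C : Code n) (m : Fin C.numMsg)
    (k : Fin C.numKey) : 0 ≤ errProb q W C m k :=
  Finset.sum_nonneg fun y _ => by
    split_ifs
    exacts [W.prodLaw_nonneg _ y, le_rfl]

theorem maxErrProb_nonneg (q : Fin 2 → Y → ℝ) (W : BDMC Y) {n : ℕ} (C : Code n) :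
    0 ≤ maxErrProb q W C :=
  Real.iSup_nonneg fun p => errProb_nonneg q W C p.1 p.2

theorem exists_law_le_const_mul {V : BDMC Z} (hV : AbsCont (V.law 1) (V.law 0)) :
    ∃ r, 2 ≤ r ∧ ∀ a z, V.law a z ≤ r * V.law 0 z := by
  have h0 : ∀ z, 0 ≤ V.law 1 z / V.law 0 z := fun z => div_nonneg (V.nonneg _ _) (V.nonneg _ _)
  have hs : 0 ≤ ∑ z, V.law 1 z / V.law 0 z := Finset.sum_nonneg fun z _ => h0 z
  refine ⟨2 + ∑ z, V.law 1 z / V.law 0 z, by linarith, fun a z => ?_⟩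
  rcases (V.nonneg 0 z).eq_or_lt with hz | hz
  · have h1 := hV z hz.symm
    rcases Fin.exists_fin_two.1 ⟨a, rfl⟩ with h | h <;> simp [h, ← hz, h1]
  · rcases Fin.exists_fin_two.1 ⟨a, rfl⟩ with h | h
    · rw [h]; nlinarith
    · rw [h, ← div_le_iff₀ hz]
      have := Finset.single_le_sum (f := fun z => V.law 1 z / V.law 0 z) (fun z _ => h0 z)
        (Finset.mem_univ z)
      linarith

theorem sum_wardenLaw (V : BDMC Z) {n : ℕ} (C : Code n) : ∑ z, wardenLaw V C z = 1 := by
  have h1 : (0 : ℝ) < C.numMsg := by exact_mod_cast C.numMsg_pos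
  have h2 : (0 : ℝ) < C.numKey := by exact_mod_cast C.numKey_pos
  simp only [wardenLaw]
  rw [← Finset.mul_sum, Finset.sum_comm]
  have h3 : ∀ m, ∑ z, ∑ k, V.prodLaw (C.word m k) z = C.numKey := fun m => by
    rw [Finset.sum_comm]; simp [V.sum_prodLaw]
  simp only [h3, Finset.sum_const, Finset.card_univ, Fintype.card_fin, nsmul_eq_mul]
  field_simp

/-- The warden's divergence depends continuously, up to a factor `n`, on the `L¹` distance of the
output law from the sparse product law, since all densities are at most exponential in `n`. -/
theorem abs_klDivergence_wardenLaw_sub_le {V : BDMC Z} {r : ℝ} (hr : 2 ≤ r)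
    (hVr : ∀ a z, V.law a z ≤ r * V.law 0 z) {α : ℝ} (hα0 : 0 ≤ α) (hα : α ≤ 1 / 2) {n : ℕ}
    (hn : 0 < n) (C : Code n) :
    |klDivergence (wardenLaw V C) (innocentLaw V n) -
        klDivergence (fun z => ∏ i, mixLaw V α (z i)) (innocentLaw V n)| ≤
      2 * (n * Real.log (2 * r)) * ∑ z, |wardenLaw V C z - ∏ i, mixLaw V α (z i)| := by
  have hexp : Real.exp (n * Real.log (2 * r)) = (2 * r) ^ n := by
    rw [Real.exp_nat_mul, Real.exp_log (by linarith)]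
  have h1M : (0 : ℝ) < C.numMsg := by exact_mod_cast C.numMsg_pos
  have h1K : (0 : ℝ) < C.numKey := by exact_mod_cast C.numKey_pos
  have hmix0 : ∀ z, 0 ≤ mixLaw V α z := fun z => by
    rw [mixLaw_eq]
    have := V.nonneg 0 z
    have := V.nonneg 1 z
    have : 0 ≤ 1 - α := by linarith
    positivity
  have hlow : ∀ z, V.law 0 z ≤ 2 * mixLaw V α z := fun z => by
    rw [mixLaw_eq]
    nlinarith [V.nonneg 0 z, mul_nonneg hα0 (V.nonneg 1 z)]
  have hup : ∀ z, mixLaw V α z ≤ r * V.law 0 z := fun z => by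
    rw [mixLaw_eq]
    nlinarith [hVr 0 z, hVr 1 z]
  have hprod : ∀ (f g : Z → ℝ) (s : ℝ) (z : Fin n → Z), (∀ b, 0 ≤ f b) → (∀ b, f b ≤ s * g b) →
      ∏ i, f (z i) ≤ s ^ n * ∏ i, g (z i) := by
    intro f g s z hf hfg
    calc ∏ i, f (z i) ≤ ∏ i, s * g (z i) :=
          Finset.prod_le_prod (fun i _ => hf _) fun i _ => hfg _
      _ = _ := by simp [Finset.prod_mul_distrib]
  have hB0 : ∀ z, 0 ≤ innocentLaw V n z := fun z => Finset.prod_nonneg fun i _ => V.nonneg _ _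
  have hQ0 : ∀ z : Fin n → Z, 0 ≤ ∏ i, mixLaw V α (z i) :=
    fun z => Finset.prod_nonneg fun i _ => hmix0 _
  have hBQ : ∀ z, innocentLaw V n z ≤ 2 ^ n * ∏ i, mixLaw V α (z i) := fun z =>
    hprod (V.law 0) (mixLaw V α) 2 z (V.nonneg 0) hlow
  have hword : ∀ (x : Fin n → Fin 2) z, V.prodLaw x z ≤ r ^ n * innocentLaw V n z := by
    intro x z
    calc V.prodLaw x z ≤ ∏ i, r * V.law 0 (z i) :=
          Finset.prod_le_prod (fun i _ => V.nonneg _ _) fun i _ => hVr _ _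
      _ = _ := by simp [Finset.prod_mul_distrib, innocentLaw]
  refine abs_klDivergence_sub_le ?_ ?_ hQ0 hB0 ?_ ?_ ?_ (sum_wardenLaw V C) ?_
  · have h1 : 1 ≤ Real.log (2 * r) := by
      rw [Real.le_log_iff_exp_le (by linarith)]
      linarith [Real.exp_one_lt_d9]
    have h2 : (1 : ℝ) ≤ n := by exact_mod_cast hn
    nlinarith
  · exact fun z => mul_nonneg (by positivity)
      (Finset.sum_nonneg fun m _ => Finset.sum_nonneg fun k _ => V.prodLaw_nonneg _ _)
  · intro z
    rw [hexp]
    calc wardenLaw V C z ≤ 1 / ((C.numMsg : ℝ) * C.numKey) *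
          ∑ _m : Fin C.numMsg, ∑ _k : Fin C.numKey, r ^ n * innocentLaw V n z := by
          unfold wardenLaw
          gcongr
          exact hword _ _
      _ = r ^ n * innocentLaw V n z := by
          simp only [Finset.sum_const, Finset.card_univ, Fintype.card_fin, nsmul_eq_mul]
          field_simp
      _ ≤ r ^ n * (2 ^ n * ∏ i, mixLaw V α (z i)) := by gcongr; exact hBQ z
      _ = _ := by rw [mul_pow]; ring
  · intro z
    rw [hexp]
    refine (hprod (mixLaw V α) (V.law 0) r z hmix0 hup).trans ?_
    exact mul_le_mul_of_nonneg_right (by gcongr; linarith) (hB0 z)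
  · intro z
    rw [hexp]
    exact (hBQ z).trans (mul_le_mul_of_nonneg_right (by gcongr; linarith) (hQ0 z))
  · have h1 := iidExp_prod (I := Fin n) (mixLaw V α) (fun _ _ => 1)
    rw [iidExp_eq] at h1
    simpa [sum_mixLaw] using h1

/-- Expurgation turns a codebook with a small mean score into a code with a small maximal error
probability, without changing the warden's law much. -/
theorem exists_code_of_codebook {q : Fin 2 → Y → ℝ} (hq : ∀ x y, 0 < q x y) (W : BDMC Y)
    (V : BDMC Z) {n : ℕ} {s t ε β ζ : ℝ} (hs : 0 ≤ s)
    (hβ : β ≤ t * rateFun q W s -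
      ε * (1 + 2 * |Real.log (∑ y, W.law 0 y * (q 1 y ^ s / q 0 y ^ s))|))
    (hζ0 : 0 < ζ) (hζ : ζ ≤ 1 / 2) {M K : ℕ} (hM0 : 0 < M) (hK0 : 0 < K)
    (c : Fin M × Fin K → Fin n → Fin 2) (Q : (Fin n → Z) → ℝ)
    (hc : 1 / ((M : ℝ) * K) * ∑ p, pairScore W (letterScore q W s) t ε β c p +
      ∑ z, |1 / ((M : ℝ) * K) * ∑ p, V.prodLaw (c p) z - Q z| ≤ ζ ^ 3) :
    ∃ C : Code n, (M : ℝ) ≤ 2 * C.numMsg ∧ C.numKey ≤ K ∧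
      ∑ z, |wardenLaw V C z - Q z| ≤ 5 * ζ ∧ maxErrProb q W C ≤ ζ := by
  set h := letterScore q W s with hh
  set S : Fin M × Fin K → ℝ := pairScore W h t ε β c with hS
  have hS0 : ∀ p, 0 ≤ S p := pairScore_nonneg W h t ε _ c
  have hSc : 1 / ((M : ℝ) * K) * ∑ p, S p ≤ ζ ^ 3 :=
    le_trans (le_add_of_nonneg_right (Finset.sum_nonneg fun z _ => abs_nonneg _)) hc
  have hL1 : ∑ z, |1 / ((M : ℝ) * K) * ∑ p, V.prodLaw (c p) z - Q z| ≤ ζ := by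
    have h1 : 0 ≤ 1 / ((M : ℝ) * K) * ∑ p, S p :=
      mul_nonneg (by positivity) (Finset.sum_nonneg fun p _ => hS0 p)
    have h2 : ζ ^ 3 ≤ ζ := pow_le_of_le_one hζ0.le (by linarith) (by norm_num)
    linarith
  obtain ⟨M', K', f, g, hf, hg, hfg, hM'0, hK'0, hMM', hKK', hMK'⟩ :=
    exists_expurgation hM0 hK0 S hS0 hζ0 hζ hSc
  let C : Code n := ⟨M', K', hM'0, hK'0, fun m k => c (g k m, f k)⟩
  refine ⟨C, hMM', hKK', ?_, ?_⟩
  · have : Nonempty (Fin M' × Fin K') := ⟨(⟨0, hM'0⟩, ⟨0, hK'0⟩)⟩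
    have hinj : Function.Injective (fun p : Fin M' × Fin K' => (g p.2 p.1, f p.2)) := by
      rintro ⟨m, k⟩ ⟨m', k'⟩ h0
      simp only [Prod.mk.injEq] at h0
      obtain rfl := hf h0.2
      rw [hg k h0.1]
    have h2 := sum_abs_avg_sub_avg_le (v := fun p z => V.prodLaw (c p) z)
      (fun p z => V.prodLaw_nonneg _ _) (fun p => V.sum_prodLaw _) hinj (ν := 2 * ζ) (by
        simpa [Fintype.card_prod] using hMK')
    simp only [Fintype.card_prod, Fintype.card_fin, Nat.cast_mul] at h2
    have h3 : ∀ z, wardenLaw V C z = 1 / ((M' : ℝ) * K') *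
        ∑ p : Fin M' × Fin K', V.prodLaw (c (g p.2 p.1, f p.2)) z := fun z => by
      rw [Fintype.sum_prod_type]; rfl
    calc _ ≤ ∑ z, (|1 / ((M' : ℝ) * K') *
            ∑ p : Fin M' × Fin K', V.prodLaw (c (g p.2 p.1, f p.2)) z -
              1 / ((M : ℝ) * K) * ∑ p, V.prodLaw (c p) z| +
            |1 / ((M : ℝ) * K) * ∑ p, V.prodLaw (c p) z - Q z|) :=
          Finset.sum_le_sum fun z _ => by rw [h3]; exact abs_sub_le _ _ _
      _ ≤ 5 * ζ := by rw [Finset.sum_add_distrib]; linarith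
  · have hscore : ∀ m k, upperDev W (fun _ => 1) t ε (c (g k m, f k)) +
        upperDev W (fun _ => -1) t ε (c (g k m, f k)) +
        upperDev W (fun b => -h b) t ε (c (g k m, f k)) +
        Real.exp (-(β * √(n : ℝ))) * ∑ m' ∈ Finset.univ.erase (g k m),
          ∑ y, W.prodLaw (c (g k m, f k)) y * Real.exp (pulseSum h (c (m', f k)) y) ≤ ζ := hfg
    have hC : ∀ m k, |weight (C.word m k) - t * √(n : ℝ)| < ε * √(n : ℝ) := by
      intro m k
      refine abs_weight_sub_lt W (lt_of_le_of_lt ?_ (show ζ < 1 by linarith))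
      refine le_trans ?_ (hscore m k)
      rw [add_assoc _ (upperDev W (fun b => -h b) t ε (c (g k m, f k)))]
      refine le_add_of_nonneg_right (add_nonneg (upperDev_nonneg _ _ _ _ _) ?_)
      exact mul_nonneg (Real.exp_pos _).le
        (Finset.sum_nonneg fun m' _ => sum_prodLaw_mul_exp_nonneg W h _ _)
    have : Nonempty (Fin C.numMsg × Fin C.numKey) := ⟨(⟨0, hM'0⟩, ⟨0, hK'0⟩)⟩
    refine ciSup_le fun ⟨m, k⟩ => ?_
    refine (errProb_le hq W hs C hβ hC m k).trans (le_trans ?_ (hscore m k))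
    refine add_le_add (le_add_of_nonneg_left
      (add_nonneg (upperDev_nonneg _ _ _ _ _) (upperDev_nonneg _ _ _ _ _))) ?_
    refine mul_le_mul_of_nonneg_left ?_ (Real.exp_pos _).le
    refine (Finset.sum_map (Finset.univ.erase m) ⟨g k, hg k⟩ (fun m' =>
      ∑ y, W.prodLaw (c (g k m, f k)) y * Real.exp (pulseSum h (c (m', f k)) y))).symm.trans_le ?_
    refine Finset.sum_le_sum_of_subset_of_nonneg ?_ fun m' _ _ =>
      sum_prodLaw_mul_exp_nonneg W h _ _
    intro m'
    simp only [Finset.mem_map, Finset.mem_erase, Finset.mem_univ, and_true,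
      Function.Embedding.coeFn_mk]
    rintro ⟨m'', hne, rfl⟩
    exact fun h0 => hne (hg k h0)

/-- Codes of prescribed sizes with small maximal error and with the limiting divergence of the
sparse product law. -/
theorem eventually_exists_code {q : Fin 2 → Y → ℝ} (hq : ∀ x y, 0 < q x y) (W : BDMC Y)
    {V : BDMC Z} (hV : AbsCont (V.law 1) (V.law 0)) {s t ρ κ : ℝ} (hs : 0 ≤ s) (ht : 0 < t)
    (hκ : 0 < κ) (hρ : ρ < t * rateFun q W s)
    (hσ : t * klDivergence (V.law 1) (V.law 0) < ρ + κ) {η : ℝ} (hη : 0 < η) :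
    ∀ᶠ n : ℕ in atTop, ∃ C : Code n,
      ρ * √(n : ℝ) - Real.log 2 ≤ Real.log C.numMsg ∧
      Real.log C.numKey ≤ κ * √(n : ℝ) + Real.log 2 ∧
      |klDivergence (wardenLaw V C) (innocentLaw V n) -
        t ^ 2 * chiSq (V.law 1) (V.law 0) / 2| ≤ η ∧
      maxErrProb q W C ≤ η := by
  set l := |Real.log (∑ y, W.law 0 y * (q 1 y ^ s / q 0 y ^ s))| with hl
  have hl0 : 0 ≤ l := abs_nonneg _
  set e := t * rateFun q W s - ρ with he
  have he0 : 0 < e := by linarith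
  -- half of the margin `e` pays for deviations of scores and weights, half for the union bound
  set ε := e / (2 * (1 + 2 * l)) with hε
  have hε0 : 0 < ε := by positivity
  have hεl : ε * (1 + 2 * l) = e / 2 := by rw [hε]; field_simp
  set h := letterScore q W s with hh
  obtain ⟨r, hr, hcode⟩ := exists_codebook W h (sum_law_zero_mul_exp_letterScore hq W s) hV ht hε0
    (show ρ < ρ + e / 2 by linarith) hσ
  obtain ⟨c₀, hc₀, hVc₀⟩ := exists_law_le_const_mul hV
  have hr3 : 0 < r / 3 := by positivity
  have hlimζ := tendsto_exp_neg_sqrt hr3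
  have hlimn := (tendsto_natCast_mul_exp_neg_sqrt hr3).const_mul (10 * Real.log (2 * c₀))
  rw [mul_zero] at hlimn
  have hkl := tendsto_klDivergence_mixLaw hV t
  rw [Metric.tendsto_nhds] at hkl
  filter_upwards [hcode, hlimζ.eventually_le_const (show (0 : ℝ) < min η (1 / 2) by positivity),
    hlimn.eventually_le_const (half_pos hη), hkl _ (half_pos hη), eventually_gt_atTop 0,
    tendsto_sqrt_natCast.eventually_ge_atTop (2 * t)] with n hn hζn hnn hkln hn0 htn
  have hs0 : 0 < √(n : ℝ) := by linarith
  set ζ := Real.exp (-(r / 3) * √(n : ℝ)) with hζ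
  have hζ0 : 0 < ζ := Real.exp_pos _
  have hζ3 : Real.exp (-r * √(n : ℝ)) = ζ ^ 3 := by
    rw [hζ, ← Real.exp_nat_mul]; congr 1; push_cast; ring
  have hζη : ζ ≤ η := hζn.trans (min_le_left _ _)
  have hζh : ζ ≤ 1 / 2 := hζn.trans (min_le_right _ _)
  set M := ⌈Real.exp (ρ * √(n : ℝ))⌉₊ with hM
  set K := ⌈Real.exp (κ * √(n : ℝ))⌉₊ with hK
  have hM0 : 0 < M := Nat.ceil_pos.2 (Real.exp_pos _)
  have hK0 : 0 < K := Nat.ceil_pos.2 (Real.exp_pos _)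
  have hMge : Real.exp (ρ * √(n : ℝ)) ≤ M := Nat.le_ceil _
  have hKge : Real.exp (κ * √(n : ℝ)) ≤ K := Nat.le_ceil _
  obtain ⟨c, hc⟩ := hn M K hM0 hK0 (by linarith [Nat.ceil_lt_add_one (Real.exp_pos (ρ * √(n : ℝ))).le])
    (by
      rw [add_mul, Real.exp_add]
      gcongr)
  rw [hζ3] at hc
  obtain ⟨C, hCM, hCK, hCL, hCe⟩ := exists_code_of_codebook hq W V hs
    (by rw [← hl, hεl]; linarith) hζ0 hζh hM0 hK0 c _ hc
  have hM'pos : (0 : ℝ) < C.numMsg := by exact_mod_cast C.numMsg_pos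
  have hK'pos : (0 : ℝ) < C.numKey := by exact_mod_cast C.numKey_pos
  refine ⟨C, ?_, ?_, ?_, hCe.trans hζη⟩
  · rw [sub_le_iff_le_add, ← Real.log_mul hM'pos.ne' two_ne_zero,
      Real.le_log_iff_exp_le (by positivity)]
    linarith
  · rw [Real.log_le_iff_le_exp hK'pos, Real.exp_add, Real.exp_log two_pos]
    have h1 : (C.numKey : ℝ) ≤ K := by exact_mod_cast hCK
    have h2 := Nat.ceil_lt_add_one (Real.exp_pos (κ * √(n : ℝ))).le
    have h3 : 1 ≤ Real.exp (κ * √(n : ℝ)) := Real.one_le_exp (by positivity)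
    linarith
  · have hα0 : 0 ≤ t / √(n : ℝ) := by positivity
    have hα : t / √(n : ℝ) ≤ 1 / 2 := by rw [div_le_iff₀ hs0]; linarith
    have h1 := abs_klDivergence_wardenLaw_sub_le hc₀ hVc₀ hα0 hα hn0 C
    have hlog : 0 ≤ Real.log (2 * c₀) := Real.log_nonneg (by linarith)
    have h5 : 2 * (n * Real.log (2 * c₀)) *
        ∑ z, |wardenLaw V C z - ∏ i, mixLaw V (t / √(n : ℝ)) (z i)| ≤ η / 2 := by
      calc _ ≤ 2 * (n * Real.log (2 * c₀)) * (5 * ζ) := by gcongr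
        _ = 10 * Real.log (2 * c₀) * (n * ζ) := by ring
        _ ≤ _ := hnn
    rw [Real.dist_eq] at hkln
    have h6 := abs_le.1 (h1.trans h5)
    have h7 := abs_lt.1 hkln
    exact abs_le.2 ⟨by linarith [h6.1, h7.1], by linarith [h6.2, h7.2]⟩

end Existence

/-! ### The rate function and passage to the limit -/

/-- The rate function is at most `D(P_1 ‖ P_0)`, by the variational formula for the divergence. -/
theorem rateFun_le_klDivergence {Y : Type*} [Fintype Y] {q : Fin 2 → Y → ℝ}
    (hq : ∀ x y, 0 < q x y) {W : BDMC Y} (hW : AbsCont (W.law 1) (W.law 0)) (s : ℝ) :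
    rateFun q W s ≤ klDivergence (W.law 1) (W.law 0) := by
  rw [← sum_law_one_mul_letterScore]
  have h1 : ∀ y, W.law 1 y * letterScore q W s y - W.law 1 y * Real.log (W.law 1 y / W.law 0 y) ≤
      W.law 0 y * Real.exp (letterScore q W s y) - W.law 1 y := by
    intro y
    rcases (W.nonneg 1 y).eq_or_lt with h | h
    · rw [← h]
      have := mul_nonneg (W.nonneg 0 y) (Real.exp_pos (letterScore q W s y)).le
      simpa using this
    · have h0 : 0 < W.law 0 y := (W.nonneg 0 y).lt_of_ne' fun h0 => h.ne' (hW y h0)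
      have hx : 0 < W.law 0 y * Real.exp (letterScore q W s y) / W.law 1 y := by positivity
      have h2 := mul_le_mul_of_nonneg_left (Real.log_le_sub_one_of_pos hx) h.le
      rw [Real.log_div (by positivity) h.ne', Real.log_mul h0.ne' (Real.exp_pos _).ne',
        Real.log_exp, mul_sub, mul_sub, mul_add, mul_div_cancel₀ _ h.ne'] at h2
      rw [Real.log_div h.ne' h0.ne']
      linarith
  have h2 := Finset.sum_le_sum fun y (_ : y ∈ Finset.univ) => h1 y
  rw [Finset.sum_sub_distrib, Finset.sum_sub_distrib, sum_law_zero_mul_exp_letterScore hq,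
    W.sum_eq_one, sub_self] at h2
  exact sub_nonpos.1 h2

/-- Diagonal choice: objects that are good up to every fixed `ε` for all large `n` can be chosen to
be good up to every `ε` eventually along one sequence. -/
theorem exists_seq_of_eventually_exists {A : ℕ → Type*} [∀ n, Nonempty (A n)]
    {p : ℝ → (n : ℕ) → A n → Prop} (hmono : ∀ n a ε ε', ε ≤ ε' → p ε n a → p ε' n a)
    (h : ∀ ε > 0, ∀ᶠ n in atTop, ∃ a, p ε n a) :
    ∃ a : (n : ℕ) → A n, ∀ ε > 0, ∀ᶠ n in atTop, p ε n (a n) := by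
  classical
  have hj : ∀ j : ℕ, ∃ N, ∀ n ≥ N, ∃ a, p (1 / ((j : ℝ) + 1)) n a := fun j =>
    eventually_atTop.1 (h _ (by positivity))
  choose N hN using hj
  set J : ℕ → ℕ := fun n => Nat.findGreatest (fun j => N j ≤ n) n with hJ
  have hex : ∀ n, ∃ a, N 0 ≤ n → p (1 / ((J n : ℝ) + 1)) n a := by
    intro n
    by_cases h0 : N 0 ≤ n
    · obtain ⟨a, ha⟩ := hN (J n) n
        (Nat.findGreatest_spec (P := fun j => N j ≤ n) (Nat.zero_le n) h0)
      exact ⟨a, fun _ => ha⟩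
    · exact ⟨Classical.arbitrary _, fun h1 => absurd h1 h0⟩
  choose a ha using hex
  refine ⟨a, fun ε hε => ?_⟩
  obtain ⟨j, hj⟩ := exists_nat_one_div_lt hε
  filter_upwards [eventually_ge_atTop (max (N 0) (max j (N j)))] with n hn
  have h0 : N 0 ≤ n := (le_max_left _ _).trans hn
  have h1 : j ≤ n := (le_max_left _ _).trans ((le_max_right _ _).trans hn)
  have h2 : N j ≤ n := (le_max_right _ _).trans ((le_max_right _ _).trans hn)
  have h3 : j ≤ J n := Nat.le_findGreatest (P := fun j => N j ≤ n) h1 h2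
  refine hmono n _ _ _ ?_ (ha n h0)
  refine le_trans ?_ hj.le
  have : (j : ℝ) ≤ J n := by exact_mod_cast h3
  gcongr

instance (n : ℕ) : Nonempty (Code n) := ⟨⟨1, 1, one_pos, one_pos, fun _ _ _ => 0⟩⟩

theorem achievable_of_eventually {Y Z : Type*} [Fintype Y] [Fintype Z] {q : Fin 2 → Y → ℝ}
    {δ : ℝ} {W : BDMC Y} {V : BDMC Z} {R RK : ℝ}
    (h : ∀ ε > 0, ∀ᶠ n : ℕ in atTop, ∃ C : Code n,
      (R - ε) * √(n : ℝ) ≤ Real.log C.numMsg ∧ Real.log C.numKey ≤ (RK + ε) * √(n : ℝ) ∧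
      |klDivergence (wardenLaw V C) (innocentLaw V n) - δ| ≤ ε ∧ maxErrProb q W C ≤ ε) :
    Achievable q δ W V R RK := by
  obtain ⟨C, hC⟩ := exists_seq_of_eventually_exists (A := Code) (p := fun ε n C =>
      (R - ε) * √(n : ℝ) ≤ Real.log C.numMsg ∧ Real.log C.numKey ≤ (RK + ε) * √(n : ℝ) ∧
      |klDivergence (wardenLaw V C) (innocentLaw V n) - δ| ≤ ε ∧ maxErrProb q W C ≤ ε)
    (fun n C ε ε' hε ⟨h1, h2, h3, h4⟩ =>
      ⟨le_trans (by gcongr) h1, h2.trans (by gcongr), h3.trans hε, h4.trans hε⟩) h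
  have hpos := tendsto_sqrt_natCast.eventually_gt_atTop 0
  refine ⟨C, ?_, ?_, ⟨δ, le_rfl, ?_⟩, ?_⟩
  · refine EReal.ge_of_forall_gt_iff_ge.1 fun z hz => ?_
    have hz' : z < R := by exact_mod_cast hz
    refine le_liminf_of_le (by isBoundedDefault) ?_
    filter_upwards [hC (R - z) (by linarith), hpos] with n hn hn0
    rw [EReal.coe_le_coe_iff, le_div_iff₀ hn0]
    linarith [hn.1]
  · refine EReal.le_of_forall_lt_iff_le.1 fun z hz => ?_
    have hz' : RK < z := by exact_mod_cast hz
    refine limsup_le_of_le (by isBoundedDefault) ?_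
    filter_upwards [hC (z - RK) (by linarith), hpos] with n hn hn0
    rw [EReal.coe_le_coe_iff, div_le_iff₀ hn0]
    linarith [hn.2.1]
  · rw [Metric.tendsto_nhds]
    intro ε hε
    filter_upwards [hC _ (half_pos hε)] with n hn
    rw [Real.dist_eq]
    linarith [hn.2.2.1]
  · rw [Metric.tendsto_nhds]
    intro ε hε
    filter_upwards [hC _ (half_pos hε)] with n hn
    rw [Real.dist_eq, sub_zero, abs_of_nonneg (maxErrProb_nonneg q W (C n))]
    linarith [hn.2.2.2]

/-- The supremum of the rate function need not be attained, so `s` is chosen for each margin `ε`; the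
key rate `RK + ε / 2` then leaves enough randomness for the soft covering of the warden's law. -/
theorem achievable_lowerRate {Y Z : Type*} [Fintype Y] [Fintype Z] {W : BDMC Y} {V : BDMC Z}
    (hV_ne : V.law 0 ≠ V.law 1) (hV_ac : AbsCont (V.law 1) (V.law 0))
    {q : Fin 2 → Y → ℝ} (hq : ∀ x y, 0 < q x y) {δ : ℝ} (hδ : 0 < δ) {RK : ℝ}
    (hRK0 : 0 ≤ RK)
    (hRK : weightParam δ V * klDivergence (V.law 1) (V.law 0) - lowerRate q δ W V ≤ RK) :
    Achievable q δ W V (lowerRate q δ W V) RK := by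
  have hχ : 0 < chiSq (V.law 1) (V.law 0) := by
    obtain ⟨z, hz⟩ := Function.ne_iff.1 hV_ne
    have hz0 : 0 < V.law 0 z := (V.nonneg 0 z).lt_of_ne' fun h0 => hz (by rw [h0, hV_ac z h0])
    have h1 : 0 < (V.law 1 z - V.law 0 z) ^ 2 := by
      have := sub_ne_zero.2 (Ne.symm hz)
      positivity
    exact Finset.sum_pos' (fun z _ => div_nonneg (sq_nonneg _) (V.nonneg 0 z))
      ⟨z, Finset.mem_univ z, div_pos h1 hz0⟩
  set t := weightParam δ V with ht
  have ht0 : 0 < t := Real.sqrt_pos.2 (by positivity)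
  have hδt : t ^ 2 * chiSq (V.law 1) (V.law 0) / 2 = δ := by
    rw [ht, weightParam, Real.sq_sqrt (by positivity)]
    field_simp
  set R := lowerRate q δ W V with hR
  refine achievable_of_eventually fun ε hε => ?_
  obtain ⟨s, hs, hsR⟩ : ∃ s, 0 ≤ s ∧ R - ε / 4 < t * rateFun q W s := by
    have h1 : sSup (rateFun q W '' Set.Ici 0) - ε / 4 / t < sSup (rateFun q W '' Set.Ici 0) :=
      sub_lt_self _ (by positivity)
    obtain ⟨_, ⟨s, hs, rfl⟩, h2⟩ := exists_lt_of_lt_csSup (Set.nonempty_Ici.image _) h1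
    refine ⟨s, hs, ?_⟩
    have h3 := mul_lt_mul_of_pos_left h2 ht0
    rw [mul_sub, mul_div_cancel₀ _ ht0.ne'] at h3
    exact h3
  have hcode := eventually_exists_code hq W hV_ac hs ht0 (κ := RK + ε / 2) (by positivity) hsR
    (by linarith) hε
  rw [hδt] at hcode
  filter_upwards [hcode, tendsto_sqrt_natCast.eventually_ge_atTop (Real.log 2 / (ε / 2))] with
    n ⟨C, hM, hK, hD, herr⟩ hn
  rw [div_le_iff₀ (by positivity)] at hn
  have := mul_nonneg hε.le (Real.sqrt_nonneg (n : ℝ))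
  exact ⟨C, by linarith, by linarith, hD, herr⟩

end CovertMismatch

theorem theorem1 {Y Z : Type*} [Fintype Y] [Fintype Z]
    (W : CovertMismatch.BDMC Y) (V : CovertMismatch.BDMC Z)
    (hV_ne : V.law 0 ≠ V.law 1)
    (hV_ac : CovertMismatch.AbsCont (V.law 1) (V.law 0))
    (hW_ac : CovertMismatch.AbsCont (W.law 1) (W.law 0))
    (q : Fin 2 → Y → ℝ) (hq : ∀ x y, 0 < q x y)
    (δ : ℝ) (hδ : 0 < δ) :
    BddAbove (CovertMismatch.rateFun q W '' Set.Ici 0) ∧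
    (∀ RK : ℝ,
      max 0 (CovertMismatch.weightParam δ V * CovertMismatch.klDivergence (V.law 1) (V.law 0) -
        CovertMismatch.lowerRate q δ W V) ≤ RK →
      CovertMismatch.Achievable q δ W V (CovertMismatch.lowerRate q δ W V) RK) ∧
    (CovertMismatch.lowerRate q δ W V : EReal) ≤ CovertMismatch.capacity q δ W V := by
  have hach : ∀ RK : ℝ,
      max 0 (CovertMismatch.weightParam δ V * CovertMismatch.klDivergence (V.law 1) (V.law 0) -
        CovertMismatch.lowerRate q δ W V) ≤ RK →
      CovertMismatch.Achievable q δ W V (CovertMismatch.lowerRate q δ W V) RK := fun RK hRK =>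
    CovertMismatch.achievable_lowerRate hV_ne hV_ac hq hδ ((le_max_left _ _).trans hRK)
      ((le_max_right _ _).trans hRK)
  refine ⟨⟨CovertMismatch.klDivergence (W.law 1) (W.law 0), ?_⟩, hach, ?_⟩
  · rintro _ ⟨s, -, rfl⟩
    exact CovertMismatch.rateFun_le_klDivergence hq hW_ac s
  · exact le_sSup ⟨_, _, hach _ le_rfl, rfl⟩
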